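/- **Setting.** Let $(Z,\{\cdot,\cdot\})$ be a Poisson manifold with $X_f\cdot h=\{h,f\}$, let $S\subset Z$ be a symplectic leaf, $X\subset S$ an embedded Lagrangian submanifold, and $Q\subset Z$ an embedded coisotropic submanifold with $S\subset Q$. Over $X$ put $$E_X=(TX)^0,\quad L_X=(TS)^0|_X,\quad A_X=(TQ)^0|_X\quad\text{in } T^*Z|_X,\qquad \tilde L_X=(TS)^0|_X\subset T^*Q|_X,$$ so that $E_X^*=TZ|_X/TX$, $\tilde L_X\cong L_X/A_X$ and $\tilde L_X^*=TQ|_X/TS|_X$; also let $\tilde E_X^*=TQ|_X/TX$, let $i_{Q'}:\tilde E_X^*\to E_X^*$ be the inclusion and $\tilde l:\tilde E_X^*\to\tilde L_X^*$ the projection. A section $s$ of $\bigoplus_i S^i(\tilde L_X)$ (a finite sum of smooth sections of the $S^i(\tilde L_X)$) defines a vertically polynomial function $\bar s$ on $\tilde L_X^*$, and hence the function $\tilde l^*\bar s$ on $\tilde E_X^*$. With $\tau:E_X^*\to X$ the projection and $\overline{df|_X}$ the fibrewise linear function defined by the section $df|_X$ of $E_X$ (for $f$ vanishing on $X$), $C^\infty(E_X^*)$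 carries the unique Poisson bracket $\{\cdot,\cdot\}'$ such that, locally, $\{\overline{df|_X},\overline{dh|_X}\}'=\overline{d\{f,h\}|_X}$, $\{\overline{df|_X},\tau^*(m|_X)\}'=\tau^*(\{f,m\}|_X)$ and $\{\tau^*(k|_X),\tau^*(m|_X)\}'=0$. Let $\mathfrak C'=\{F\in C^\infty(E_X^*): F\circ i_{Q'}=0\}$, let $\mathfrak N'=\{F: \{F,\mathfrak C'\}'\subset\mathfrak C'\}$ be the admissible functions, and $\tilde{\mathfrak P}'=i_{Q'}^*\mathfrak N'$. The fibres of $L_X$ are Lie algebras under $[df_x,dh_x]=d\{f,h\}_x$. Let $\mathfrak c$ be a Lie subalgebra of a finite-dimensional real Lie algebra $\mathfrak g$, and assume that for every $x\in X$ there is a Lie algebra isomorphism $a:\mathfrak g\to (L_X)_x$ with $a(\mathfrak c)=(A_X)_x$. Let $R^{\mathfrak c}_X\to X$ be the bundle of all such $a$, on which the group $N$ of automorphisms of $\mathfrak g$ stabilizing $\mathfrak c$ acts from the right. Let $C$ be the analytic subgroup defined by $\mathfrak c$ in a Lie group with Lie algebra $\mathfrak g$, so that $\mathrm{Ad}(C)$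 is generated by the $\exp(\mathrm{ad}\,\xi)$, $\xi\in\mathfrak c$; let $S^i(\mathfrak g/\mathfrak c)^C$ be the space of invariants of the induced action. Let $K_i$ be the kernel of the representation of $N$ on $S^i(\mathfrak g/\mathfrak c)^C$, $\tilde R_i=R_X^{\mathfrak c}/K_i$, $\tilde N_i=N/K_i$, and $$\tilde L_i=(\tilde R_i\times S^i(\mathfrak g/\mathfrak c)^C)/\tilde N_i\ \subset\ S^i(\tilde L_X),$$ where $[[a],s]$ is identified with the image of $s$ under the map induced by $a:\mathfrak g/\mathfrak c\cong (L_X/A_X)_x\cong(\tilde L_X)_x$. Smooth sections of $\tilde L_i$ are the smooth sections of $S^i(\tilde L_X)$ with values in $\tilde L_i$. Write $\tilde R_X=\tilde R_1$, $\tilde N=\tilde N_1$. **Lemma.** The functions in $\tilde l^*C^\infty(\tilde L_X^*)\cap\tilde{\mathfrak P}'$ that are vertically polynomial (polynomial of bounded degree on the fibres) are exactly the functions $\tilde l^*\bar s$ defined by the sections $s$ of $\bigoplus_{i\ge0}\tilde L_i$. In particular, writing $\bar\Gamma(\cdot)$ for the functions on $\tilde E_X^*$ defined by smooth sections, $$\bar\Gamma(\tilde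 L_X)\cap\tilde{\mathfrak P}'=\bar\Gamma(\tilde L_1).$$ Moreover $(\mathfrak g/\mathfrak c)^C=\tilde{\mathfrak g}:=\mathfrak N_{\mathfrak g}(\mathfrak c)/\mathfrak c$, where $\mathfrak N_{\mathfrak g}(\mathfrak c)$ is the idealizer of $\mathfrak c$ in $\mathfrak g$, and $\tilde L_1=(\tilde R_X\times\tilde{\mathfrak g})/\tilde N$. -/

import Mathlib

open scoped Manifold ContDiff
open Bundle Filter Topology

noncomputable section

namespace SternbergWeinstein

section Algebra

/-- The `i`-th symmetric power `S^i(V)`, as the degree `i` part of the symmetric algebra. -/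
def symPow (V : Type*) [AddCommMonoid V] [Module ℝ V] (i : ℕ) :
    Submodule ℝ (SymmetricAlgebra ℝ V) :=
  LinearMap.range (SymmetricAlgebra.ι ℝ V) ^ i

/-- The algebra morphism `S(V) → S(W)` induced by a linear map `V → W`. -/
def symMap {V W : Type*} [AddCommMonoid V] [Module ℝ V] [AddCommMonoid W] [Module ℝ W]
    (f : V →ₗ[ℝ] W) : SymmetricAlgebra ℝ V →ₐ[ℝ] SymmetricAlgebra ℝ W :=
  SymmetricAlgebra.lift (SymmetricAlgebra.ι ℝ W ∘ₗ f)

theorem symMap_id (V : Type*) [AddCommMonoid V] [Module ℝ V] :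
    symMap (LinearMap.id : V →ₗ[ℝ] V) = AlgHom.id ℝ _ := by
  apply SymmetricAlgebra.algHom_ext
  ext v
  simp [symMap]

theorem symMap_comp {V W U : Type*} [AddCommMonoid V] [Module ℝ V] [AddCommMonoid W] [Module ℝ W]
    [AddCommMonoid U] [Module ℝ U] (f : W →ₗ[ℝ] U) (g : V →ₗ[ℝ] W) :
    symMap (f ∘ₗ g) = (symMap f).comp (symMap g) := by
  apply SymmetricAlgebra.algHom_ext
  ext v
  simp [symMap]

theorem symMap_mem_symPow {V W : Type*} [AddCommMonoid V] [Module ℝ V] [AddCommMonoid W]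
    [Module ℝ W] (f : V →ₗ[ℝ] W) (i : ℕ) {s : SymmetricAlgebra ℝ V} (hs : s ∈ symPow V i) :
    symMap f s ∈ symPow W i := by
  have h : (symPow V i).map (symMap f).toLinearMap ≤ symPow W i := by
    unfold symPow
    rw [Submodule.map_pow]
    refine pow_le_pow_left' ?_ i
    rintro _ ⟨_, ⟨v, rfl⟩, rfl⟩
    exact ⟨f v, by simp [symMap]⟩
  exact h ⟨s, hs, rfl⟩

/-- `e = exp(A)` for an endomorphism of a finite-dimensional real vector space: the exponential
series converges to `e` (coordinatewise, i.e. after applying any linear functional). -/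
def IsExp {V : Type*} [AddCommGroup V] [Module ℝ V] (A : Module.End ℝ V) (e : V ≃ₗ[ℝ] V) : Prop :=
  ∀ (v : V) (l : Module.Dual ℝ V),
    HasSum (fun n : ℕ => (n.factorial : ℝ)⁻¹ * l ((A ^ n) v)) (l (e v))

/-- The subgroup of `GL(V)` stabilizing the subspace `W`. -/
def linStab {V : Type*} [AddCommGroup V] [Module ℝ V] (W : Submodule ℝ V) :
    Subgroup (V ≃ₗ[ℝ] V) where
  carrier := {u | ∀ v, u v ∈ W ↔ v ∈ W}
  mul_mem' := fun {a b} ha hb v => (ha (b v)).trans (hb v)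
  one_mem' := fun _ => Iff.rfl
  inv_mem' := fun {a} ha v => by
    have := ha (a⁻¹ v)
    have h2 : a (a⁻¹ v) = v := a.apply_symm_apply v
    rw [h2] at this
    exact this.symm

/-- The action of the stabilizer of `W` on `V / W`. -/
def quotAct {V : Type*} [AddCommGroup V] [Module ℝ V] (W : Submodule ℝ V) :
    linStab W →* Module.End ℝ (V ⧸ W) where
  toFun u := W.mapQ W (u : V ≃ₗ[ℝ] V).toLinearMap (fun v hv => (u.2 v).2 hv)
  map_one' := by ext v; rfl
  map_mul' a b := by ext v; rfl

/-- The induced action of the stabilizer of `W` on the symmetric algebra `S(V / W)`. -/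
def symQuotAct {V : Type*} [AddCommGroup V] [Module ℝ V] (W : Submodule ℝ V) :
    linStab W →* Module.End ℝ (SymmetricAlgebra ℝ (V ⧸ W)) where
  toFun u := (symMap (quotAct W u)).toLinearMap
  map_one' := by
    rw [map_one]
    exact congrArg AlgHom.toLinearMap (symMap_id (V ⧸ W))
  map_mul' a b := by
    rw [map_mul]
    exact congrArg AlgHom.toLinearMap (symMap_comp (quotAct W a) (quotAct W b))

variable {g : Type*} [LieRing g] [LieAlgebra ℝ g]

/-- `Ad(C) ⊆ GL(g)`, for the analytic subgroup `C` with Lie algebra `c` in any Lie group with Lie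
algebra `g`: as `C` is generated by `exp c` and `Ad(exp ξ) = exp(ad ξ)`, it is the group generated
by the `exp(ad ξ)` with `ξ ∈ c`. -/
def adGroup (c : LieSubalgebra ℝ g) : Subgroup (g ≃ₗ[ℝ] g) :=
  Subgroup.closure {u | ∃ ξ ∈ c, IsExp (LieAlgebra.ad ℝ g ξ) u}

theorem isExp_conj {V : Type*} [AddCommGroup V] [Module ℝ V] {A B : Module.End ℝ V}
    {e n : V ≃ₗ[ℝ] V} (h : IsExp A e) (hAB : ∀ v, n (A v) = B (n v)) :
    IsExp B (n * e * n⁻¹) := by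
  intro v l
  have hp : ∀ (k : ℕ) (w : V), n ((A ^ k) w) = (B ^ k) (n w) := by
    intro k
    induction k with
    | zero => intro w; rfl
    | succ k ih =>
      intro w
      rw [pow_succ, pow_succ, Module.End.mul_apply, Module.End.mul_apply, ih, hAB]
  have hv : n (n⁻¹ v) = v := n.apply_symm_apply v
  have := h (n⁻¹ v) (l ∘ₗ n.toLinearMap)
  simpa [hp, hv] using this

theorem isExp_mem {V : Type*} [AddCommGroup V] [Module ℝ V] {A : Module.End ℝ V}
    {e : V ≃ₗ[ℝ] V} (h : IsExp A e) (W : Submodule ℝ V) (hA : ∀ v ∈ W, A v ∈ W) {v : V}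
    (hv : v ∈ W) : e v ∈ W := by
  by_contra hne
  obtain ⟨l, hl, hW⟩ := Submodule.exists_le_ker_of_notMem hne
  have hp : ∀ k : ℕ, (A ^ k) v ∈ W := by
    intro k
    induction k with
    | zero => simpa using hv
    | succ k ih => rw [pow_succ', Module.End.mul_apply]; exact hA _ ih
  have h0 : ∀ k : ℕ, l ((A ^ k) v) = 0 := fun k => hW (hp k)
  have := h v l
  simp only [h0, mul_zero] at this
  exact hl (this.unique hasSum_zero)

/-- `exp(A)` preserves an `A`-stable finite-dimensional subspace. -/
theorem isExp_mem_linStab {V : Type*} [AddCommGroup V] [Module ℝ V] [FiniteDimensional ℝ V]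
    {A : Module.End ℝ V} {e : V ≃ₗ[ℝ] V} (h : IsExp A e) (W : Submodule ℝ V)
    (hA : ∀ v ∈ W, A v ∈ W) : e ∈ linStab W := by
  have hle : W.map e.toLinearMap ≤ W := by
    rintro _ ⟨v, hv, rfl⟩
    exact isExp_mem h W hA hv
  have heq : W.map e.toLinearMap = W :=
    Submodule.eq_of_le_of_finrank_eq hle (LinearEquiv.finrank_map_eq e W)
  intro v
  constructor
  · intro hv
    rw [← heq] at hv
    obtain ⟨w, hw, hwv⟩ := hv
    have : w = v := e.injective hwv
    exact this ▸ hw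
  · exact fun hv => isExp_mem h W hA hv

theorem adGroup_le_linStab [FiniteDimensional ℝ g] (c : LieSubalgebra ℝ g) :
    adGroup c ≤ linStab c.toSubmodule := by
  rw [adGroup, Subgroup.closure_le]
  rintro u ⟨ξ, hξ, hu⟩
  exact isExp_mem_linStab hu c.toSubmodule (fun v hv => c.lie_mem hξ hv)

/-- `N = N_{Aut(g)}(c)`: the Lie algebra automorphisms of `g` that stabilize `c`. -/
def autStab (c : LieSubalgebra ℝ g) : Subgroup (g ≃ₗ[ℝ] g) :=
  linStab c.toSubmodule ⊓
    { carrier := {u | ∀ ξ η : g, u ⁅ξ, η⁆ = ⁅u ξ, u η⁆}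
      mul_mem' := fun {a b} ha hb ξ η => by
        change a (b ⁅ξ, η⁆) = ⁅a (b ξ), a (b η)⁆
        rw [hb, ha]
      one_mem' := fun _ _ => rfl
      inv_mem' := fun {a} ha ξ η => by
        apply a.injective
        have h : ∀ ζ, a (a⁻¹ ζ) = ζ := a.apply_symm_apply
        rw [ha, h, h, h] }

theorem autStab_le_linStab (c : LieSubalgebra ℝ g) : autStab c ≤ linStab c.toSubmodule :=
  inf_le_left

/-- `N` normalizes `Ad(C)`. -/
theorem conj_mem_adGroup (c : LieSubalgebra ℝ g) {n u : g ≃ₗ[ℝ] g} (hn : n ∈ autStab c)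
    (hu : u ∈ adGroup c) : n * u * n⁻¹ ∈ adGroup c := by
  have h : adGroup c ≤ (adGroup c).comap (MulAut.conj n).toMonoidHom := by
    rw [adGroup, Subgroup.closure_le]
    rintro u ⟨ξ, hξ, hu⟩
    exact Subgroup.subset_closure ⟨n ξ, (hn.1 ξ).2 hξ, isExp_conj hu (fun v => hn.2 ξ v)⟩
  exact h hu

/-- The reduced Lie algebra `N_g(c)/c`, as a subspace of `g/c`. -/
def redLieAlg (c : LieSubalgebra ℝ g) : Submodule ℝ (g ⧸ c.toSubmodule) :=
  c.normalizer.toSubmodule.map c.toSubmodule.mkQ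

variable [FiniteDimensional ℝ g]

/-- `S^i(g/c)^C`: the elements of `S^i(g/c)` that are invariant under `Ad_*(C)`. -/
def symInv (c : LieSubalgebra ℝ g) (i : ℕ) :
    Submodule ℝ (SymmetricAlgebra ℝ (g ⧸ c.toSubmodule)) :=
  symPow (g ⧸ c.toSubmodule) i ⊓
    ⨅ u : adGroup c, LinearMap.ker
      (symQuotAct c.toSubmodule ⟨u, adGroup_le_linStab c u.2⟩ - LinearMap.id)

theorem mem_symInv (c : LieSubalgebra ℝ g) (i : ℕ)
    (s : SymmetricAlgebra ℝ (g ⧸ c.toSubmodule)) :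
    s ∈ symInv c i ↔ s ∈ symPow (g ⧸ c.toSubmodule) i ∧
      ∀ (u : g ≃ₗ[ℝ] g) (hu : u ∈ adGroup c),
        symQuotAct c.toSubmodule ⟨u, adGroup_le_linStab c hu⟩ s = s := by
  simp [symInv, sub_eq_zero]

theorem symQuotAct_mem_symInv (c : LieSubalgebra ℝ g) (i : ℕ) (n : autStab c)
    {s : SymmetricAlgebra ℝ (g ⧸ c.toSubmodule)} (hs : s ∈ symInv c i) :
    symQuotAct c.toSubmodule ⟨n, autStab_le_linStab c n.2⟩ s ∈ symInv c i := by
  rw [mem_symInv] at hs ⊢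
  refine ⟨symMap_mem_symPow _ i hs.1, fun u hu => ?_⟩
  have hu' : (n : g ≃ₗ[ℝ] g)⁻¹ * u * n ∈ adGroup c := by
    have := conj_mem_adGroup c (autStab c |>.inv_mem n.2) hu
    simpa using this
  have key := hs.2 _ hu'
  have hmul : (⟨u, adGroup_le_linStab c hu⟩ : linStab c.toSubmodule)
      * ⟨n, autStab_le_linStab c n.2⟩ = ⟨n, autStab_le_linStab c n.2⟩
        * ⟨(n : g ≃ₗ[ℝ] g)⁻¹ * u * n, adGroup_le_linStab c hu'⟩ := by
    apply Subtype.ext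
    change u * (n : g ≃ₗ[ℝ] g) = n * ((n : g ≃ₗ[ℝ] g)⁻¹ * u * n)
    group
  rw [← Module.End.mul_apply, ← map_mul, hmul, map_mul, Module.End.mul_apply, key]

/-- The representation `k_i` of `N` on `S^i(g/c)^C`. -/
def invRep (c : LieSubalgebra ℝ g) (i : ℕ) : autStab c →* Module.End ℝ (symInv c i) where
  toFun n := (symQuotAct c.toSubmodule ⟨n, autStab_le_linStab c n.2⟩).restrict
    (fun _ hs => symQuotAct_mem_symInv c i n hs)
  map_one' := by
    ext s
    have h : (⟨((1 : autStab c) : g ≃ₗ[ℝ] g), autStab_le_linStab c (1 : autStab c).2⟩ :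
      linStab c.toSubmodule) = 1 := rfl
    simp only [h, map_one]
    rfl
  map_mul' a b := by
    ext s
    have h : (⟨((a * b : autStab c) : g ≃ₗ[ℝ] g), autStab_le_linStab c (a * b).2⟩ :
      linStab c.toSubmodule) = ⟨a, autStab_le_linStab c a.2⟩ * ⟨b, autStab_le_linStab c b.2⟩ := rfl
    simp only [h, map_mul]
    rfl

/-- `K_i = ker k_i`. -/
abbrev invKer (c : LieSubalgebra ℝ g) (i : ℕ) : Subgroup (autStab c) := (invRep c i).ker

/-- The quotient structure group `N_i = N / K_i`. -/
abbrev QuotGroup (c : LieSubalgebra ℝ g) (i : ℕ) : Type _ := autStab c ⧸ invKer c i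

/-- The (effective) action of `N_i` on `S^i(g/c)^C`. -/
def quotRep (c : LieSubalgebra ℝ g) (i : ℕ) : QuotGroup c i →* Module.End ℝ (symInv c i) :=
  QuotientGroup.lift (invKer c i) (invRep c i) (fun _ hn => hn)

end Algebra

section Manifolds

variable {E Z : Type*} [NormedAddCommGroup E] [NormedSpace ℝ E] [TopologicalSpace Z]
  [ChartedSpace E Z]

variable (E Z) in
/-- A Poisson structure on the manifold `Z`: a Lie bracket on `C^∞(Z)` which is a derivation of the
associative algebra `C^∞(Z)` in each argument. -/
structure PoissonStructure where
  bracket : C^∞⟮𝓘(ℝ, E), Z; ℝ⟯ →ₗ[ℝ] C^∞⟮𝓘(ℝ, E), Z; ℝ⟯ →ₗ[ℝ] C^∞⟮𝓘(ℝ, E), Z; ℝ⟯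
  bracket_self : ∀ f, bracket f f = 0
  jacobi : ∀ f h k,
    bracket f (bracket h k) + bracket h (bracket k f) + bracket k (bracket f h) = 0
  leibniz : ∀ f h k, bracket (f * h) k = f * bracket h k + h * bracket f k

/-- The differential `df_z` of a smooth function. -/
def diffAt (f : C^∞⟮𝓘(ℝ, E), Z; ℝ⟯) (z : Z) : Module.Dual ℝ (TangentSpace 𝓘(ℝ, E) z) :=
  (mfderiv 𝓘(ℝ, E) 𝓘(ℝ, ℝ) f z : TangentSpace 𝓘(ℝ, E) z →L[ℝ] ℝ).toLinearMap

/-- `v = X_f(z)`, where the Hamiltonian vector field is given by `X_f · h = {h, f}`. -/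
def PoissonStructure.IsHamiltonianVec (P : PoissonStructure E Z) (f : C^∞⟮𝓘(ℝ, E), Z; ℝ⟯) (z : Z)
    (v : TangentSpace 𝓘(ℝ, E) z) : Prop :=
  ∀ h : C^∞⟮𝓘(ℝ, E), Z; ℝ⟯, diffAt h z v = P.bracket h f z

variable {EM M : Type*} [NormedAddCommGroup EM] [NormedSpace ℝ EM] [TopologicalSpace M]
  [ChartedSpace EM M]

/-- `j : M → Z` is (the inclusion of) a symplectic leaf: an injectively immersed connected integral
manifold of the distribution spanned by the Hamiltonian vector fields which is maximal, i.e. every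
Hamiltonian trajectory that meets it stays in it. -/
structure PoissonStructure.IsSymplecticLeaf (P : PoissonStructure E Z) (j : M → Z) : Prop where
  connected : ConnectedSpace M
  immersion : Manifold.IsImmersion 𝓘(ℝ, EM) 𝓘(ℝ, E) ∞ j
  injective : Function.Injective j
  tangent : ∀ (m : M) (v : TangentSpace 𝓘(ℝ, E) (j m)),
    v ∈ LinearMap.range (mfderiv 𝓘(ℝ, EM) 𝓘(ℝ, E) j m).toLinearMap ↔
      ∃ f, P.IsHamiltonianVec f (j m) v
  maximal : ∀ (f : C^∞⟮𝓘(ℝ, E), Z; ℝ⟯) (a b : ℝ) (γ : ℝ → Z),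
    (∀ t ∈ Set.Ioo a b, ∀ h : C^∞⟮𝓘(ℝ, E), Z; ℝ⟯,
      HasDerivAt (fun s => h (γ s)) (P.bracket h f (γ t)) t) →
    (∃ t ∈ Set.Ioo a b, γ t ∈ Set.range j) → ∀ t ∈ Set.Ioo a b, γ t ∈ Set.range j

/-- `j : M → Z` is coisotropic: the bivector vanishes on the annihilator of `TM`. -/
def PoissonStructure.IsCoisotropic (P : PoissonStructure E Z) (j : M → Z) : Prop :=
  ∀ (m : M) (f h : C^∞⟮𝓘(ℝ, E), Z; ℝ⟯),
    (∀ v, diffAt f (j m) (mfderiv 𝓘(ℝ, EM) 𝓘(ℝ, E) j m v) = 0) →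
    (∀ v, diffAt h (j m) (mfderiv 𝓘(ℝ, EM) 𝓘(ℝ, E) j m v) = 0) →
    P.bracket f h (j m) = 0

end Manifolds

section NormalBundles

variable {EX X EM M : Type*} [NormedAddCommGroup EX] [NormedSpace ℝ EX] [TopologicalSpace X]
  [ChartedSpace EX X] [NormedAddCommGroup EM] [NormedSpace ℝ EM] [TopologicalSpace M]
  [ChartedSpace EM M]

/-- The total space of the bundle over `X` with fibres `T_{p(x)}M / W_x`, for a smooth map
`p : X → M` and a subbundle `W` of `TM|_X = p^*TM`. -/
def NormalBundle (p : C^∞⟮𝓘(ℝ, EX), X; 𝓘(ℝ, EM), M⟯)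
    (W : ∀ x, Submodule ℝ (TangentSpace 𝓘(ℝ, EM) (p x))) : Type _ :=
  Σ x : X, TangentSpace 𝓘(ℝ, EM) (p x) ⧸ W x

/-- The total space of the vector bundle `TM|_X = p^*TM`. -/
abbrev PullbackTangent (p : C^∞⟮𝓘(ℝ, EX), X; 𝓘(ℝ, EM), M⟯) : Type _ :=
  TotalSpace EM (p *ᵖ (TangentSpace 𝓘(ℝ, EM) : M → Type _))

/-- The quotient map `TM|_X → TM|_X / W`. -/
def NormalBundle.proj {p : C^∞⟮𝓘(ℝ, EX), X; 𝓘(ℝ, EM), M⟯}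
    {W : ∀ x, Submodule ℝ (TangentSpace 𝓘(ℝ, EM) (p x))} (e : PullbackTangent p) :
    NormalBundle p W :=
  ⟨e.proj, (W e.proj).mkQ e.snd⟩

/-- `F ∈ C^∞(TM|_X / W)`: the projection from `TM|_X` is a surjective submersion, so a
function on the quotient is smooth iff its pull-back to the vector bundle `TM|_X` is smooth. -/
def NormalBundle.IsSmooth [IsManifold 𝓘(ℝ, EM) ∞ M] {p : C^∞⟮𝓘(ℝ, EX), X; 𝓘(ℝ, EM), M⟯}
    {W : ∀ x, Submodule ℝ (TangentSpace 𝓘(ℝ, EM) (p x))} (F : NormalBundle p W → ℝ) : Prop :=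
  ContMDiff (𝓘(ℝ, EX).prod 𝓘(ℝ, EM)) 𝓘(ℝ, ℝ) ∞
    (fun e : PullbackTangent p => F (NormalBundle.proj e))

end NormalBundles

/-- Smooth maps `X → S → Q → Z`, which will be the inclusions of submanifolds. -/
structure Inclusions (EX X ES S EQ Q E Z : Type*)
    [NormedAddCommGroup EX] [NormedSpace ℝ EX] [TopologicalSpace X] [ChartedSpace EX X]
    [NormedAddCommGroup ES] [NormedSpace ℝ ES] [TopologicalSpace S] [ChartedSpace ES S]
    [NormedAddCommGroup EQ] [NormedSpace ℝ EQ] [TopologicalSpace Q] [ChartedSpace EQ Q]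
    [NormedAddCommGroup E] [NormedSpace ℝ E] [TopologicalSpace Z] [ChartedSpace E Z] where
  iX : C^∞⟮𝓘(ℝ, EX), X; 𝓘(ℝ, ES), S⟯
  iS : C^∞⟮𝓘(ℝ, ES), S; 𝓘(ℝ, EQ), Q⟯
  iQ : C^∞⟮𝓘(ℝ, EQ), Q; 𝓘(ℝ, E), Z⟯

namespace Inclusions

variable {EX X ES S EQ Q E Z : Type*}
  [NormedAddCommGroup EX] [NormedSpace ℝ EX] [TopologicalSpace X] [ChartedSpace EX X]
  [NormedAddCommGroup ES] [NormedSpace ℝ ES] [TopologicalSpace S] [ChartedSpace ES S]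
  [NormedAddCommGroup EQ] [NormedSpace ℝ EQ] [TopologicalSpace Q] [ChartedSpace EQ Q]
  [NormedAddCommGroup E] [NormedSpace ℝ E] [TopologicalSpace Z] [ChartedSpace E Z]
  (J : Inclusions EX X ES S EQ Q E Z)

/-- The inclusion `X → Q`. -/
def toQ : C^∞⟮𝓘(ℝ, EX), X; 𝓘(ℝ, EQ), Q⟯ := J.iS.comp J.iX

/-- The inclusion `X → Z`. -/
def toZ : C^∞⟮𝓘(ℝ, EX), X; 𝓘(ℝ, E), Z⟯ := J.iQ.comp J.toQ

/-- The tangent map `T i_Q : T_xQ → T_xZ` at a point `x` of `X`. -/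
def tangentQ (x : X) : TangentSpace 𝓘(ℝ, EQ) (J.toQ x) →ₗ[ℝ] TangentSpace 𝓘(ℝ, E) (J.toZ x) :=
  (mfderiv 𝓘(ℝ, EQ) 𝓘(ℝ, E) J.iQ (J.toQ x)).toLinearMap

/-- `T_xX` as a subspace of `T_xQ`. -/
def TXinQ (x : X) : Submodule ℝ (TangentSpace 𝓘(ℝ, EQ) (J.toQ x)) :=
  LinearMap.range (mfderiv 𝓘(ℝ, EX) 𝓘(ℝ, EQ) J.toQ x).toLinearMap

/-- `T_xS` as a subspace of `T_xQ`. -/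
def TSinQ (x : X) : Submodule ℝ (TangentSpace 𝓘(ℝ, EQ) (J.toQ x)) :=
  LinearMap.range (mfderiv 𝓘(ℝ, ES) 𝓘(ℝ, EQ) J.iS (J.iX x)).toLinearMap

/-- `T_xX` as a subspace of `T_xZ`. -/
def TX (x : X) : Submodule ℝ (TangentSpace 𝓘(ℝ, E) (J.toZ x)) := (J.TXinQ x).map (J.tangentQ x)

/-- `T_xS` as a subspace of `T_xZ`. -/
def TS (x : X) : Submodule ℝ (TangentSpace 𝓘(ℝ, E) (J.toZ x)) := (J.TSinQ x).map (J.tangentQ x)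

theorem TXinQ_le_TSinQ (x : X) : J.TXinQ x ≤ J.TSinQ x := by
  have h : mfderiv 𝓘(ℝ, EX) 𝓘(ℝ, EQ) J.toQ x =
      (mfderiv 𝓘(ℝ, ES) 𝓘(ℝ, EQ) J.iS (J.iX x)).comp (mfderiv 𝓘(ℝ, EX) 𝓘(ℝ, ES) J.iX x) :=
    mfderiv_comp x (J.iS.contMDiff.mdifferentiable (by simp) _)
      (J.iX.contMDiff.mdifferentiable (by simp) _)
  rintro _ ⟨v, rfl⟩
  exact ⟨mfderiv 𝓘(ℝ, EX) 𝓘(ℝ, ES) J.iX x v, by rw [h]; rfl⟩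

/-- `X` is Lagrangian in the leaf `S`: for all `x`, `T_xX` is its own orthogonal in `T_xS` with
respect to the symplectic form, which is given by `ω(X_f, v) = df(v)`. -/
def IsLagrangian (P : PoissonStructure E Z) : Prop :=
  ∀ (x : X), ∀ v ∈ J.TS x, v ∈ J.TX x ↔
    ∀ u ∈ J.TX x, ∀ f, P.IsHamiltonianVec f (J.toZ x) u → diffAt f (J.toZ x) v = 0

/-- `E_X^* = TZ|_X / TX`. -/
abbrev EDual : Type _ := NormalBundle J.toZ J.TX

/-- `Q' = TQ|_X / TX`, the dual Lie algebroid quotient bundle. -/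
abbrev EQuotDual : Type _ := NormalBundle J.toQ J.TXinQ

/-- `TQ|_X / TS|_X`, the dual Lie algebra quotient bundle. -/
abbrev LQuotDual : Type _ := NormalBundle J.toQ J.TSinQ

/-- The inclusion `i_{Q'} : TQ|_X / TX → TZ|_X / TX`. -/
def inclQ' (e : J.EQuotDual) : J.EDual :=
  ⟨e.1, (J.TXinQ e.1).mapQ (J.TX e.1) (J.tangentQ e.1) (Submodule.le_comap_map _ _) e.2⟩

/-- The projection `TQ|_X / TX → TQ|_X / TS|_X`. -/
def projL (e : J.EQuotDual) : J.LQuotDual :=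
  ⟨e.1, Submodule.factor (J.TXinQ_le_TSinQ e.1) e.2⟩

section Bracket

variable (P : PoissonStructure E Z) [IsManifold 𝓘(ℝ, E) ∞ Z]

/-- `dF = d(\bar{df|_X} + τ^*(k|_X))` at the point `[e]` of `E_X^*`, where `f` vanishes on `X` near
the base point of `e` (the equality is tested after pull-back by the submersion `TZ|_X → E_X^*`).
Here `\bar{df|_X}` is the fibrewise linear function given by the section `df|_X` of `E_X = (TX)^0`,
and `τ` is the projection to `X`. -/
def IsFirstJet (F : J.EDual → ℝ) (e : PullbackTangent J.toZ)
    (f k : C^∞⟮𝓘(ℝ, E), Z; ℝ⟯) : Prop :=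
  (∀ᶠ x in 𝓝 e.proj, f (J.toZ x) = 0) ∧
  mfderiv (𝓘(ℝ, EX).prod 𝓘(ℝ, E)) 𝓘(ℝ, ℝ)
      (fun e' : PullbackTangent J.toZ => F (NormalBundle.proj e')) e =
    mfderiv (𝓘(ℝ, EX).prod 𝓘(ℝ, E)) 𝓘(ℝ, ℝ)
      (fun e' : PullbackTangent J.toZ =>
        diffAt f (J.toZ e'.proj) e'.snd + k (J.toZ e'.proj)) e

/-- The Sternberg-Weinstein Poisson bracket on `C^∞(E_X^*)`. It is the bracket given by
`{\bar{df}, \bar{dh}}' = \bar{d{f, h}}`, `{\bar{df}, τ^*m}' = τ^*{f, m}` and `{τ^*k, τ^*m}' = 0`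
on the functions `\bar{df|_X}` with `f` vanishing on `X` and `τ^*(k|_X)`; their differentials span
the cotangent spaces of `E_X^*`, so this determines the value `{F, G}'(ξ)` for all `F`, `G`. -/
def swBracket (F G : J.EDual → ℝ) (ξ : J.EDual) : ℝ :=
  Classical.epsilon fun r : ℝ =>
    ∃ (e : PullbackTangent J.toZ) (f k h m : C^∞⟮𝓘(ℝ, E), Z; ℝ⟯),
      NormalBundle.proj e = ξ ∧ J.IsFirstJet F e f k ∧ J.IsFirstJet G e h m ∧
      r = diffAt (P.bracket f h) (J.toZ e.proj) e.snd
        + P.bracket f m (J.toZ e.proj) - P.bracket h k (J.toZ e.proj)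

/-- The constraint algebra `{f ∈ C^∞(E_X^*) | f|_{Q'} = 0}`. -/
def constraints : Set (J.EDual → ℝ) :=
  {F | NormalBundle.IsSmooth F ∧ ∀ e, F (J.inclQ' e) = 0}

/-- The admissible functions on `E_X^*`, i.e. the idealizer of the constraint algebra in the Poisson
algebra `C^∞(E_X^*)` (brackets of smooth functions being smooth, `{F, G}'` is a constraint iff it
vanishes on `Q'`). -/
def admissible : Set (J.EDual → ℝ) :=
  {F | NormalBundle.IsSmooth F ∧ ∀ G ∈ J.constraints, ∀ e, J.swBracket P F G (J.inclQ' e) = 0}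

/-- The reduced Poisson algebra, consisting of the restrictions to `Q'` of admissible functions. -/
def reducedAlgebra : Set (J.EQuotDual → ℝ) :=
  {φ | ∃ F ∈ J.admissible P, φ = F ∘ J.inclQ'}

end Bracket

section Frames

/-- The fibre `(T_xS)^0 ⊆ T_x^*Z` of `L_X`. -/
def LFiber (x : X) : Submodule ℝ (Module.Dual ℝ (TangentSpace 𝓘(ℝ, E) (J.toZ x))) :=
  (J.TS x).dualAnnihilator

/-- The fibre `(T_xQ)^0 ⊆ T_x^*Z` of the annihilator bundle. -/
def AFiber (x : X) : Submodule ℝ (Module.Dual ℝ (TangentSpace 𝓘(ℝ, E) (J.toZ x))) :=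
  (LinearMap.range (J.tangentQ x)).dualAnnihilator

/-- The fibre `(T_xS)^0 ⊆ T_x^*Q` of the Lie algebra quotient bundle. -/
def LQuotFiber (x : X) : Type _ := (J.TSinQ x).dualAnnihilator

instance (x : X) : AddCommGroup (J.LQuotFiber x) :=
  inferInstanceAs (AddCommGroup (J.TSinQ x).dualAnnihilator)

instance (x : X) : Module ℝ (J.LQuotFiber x) :=
  inferInstanceAs (Module ℝ (J.TSinQ x).dualAnnihilator)

/-- `(T i_Q)^*` maps the fibre of `L_X` to the fibre of the Lie algebra quotient bundle. -/
def restrictL (x : X) : J.LFiber x →ₗ[ℝ] J.LQuotFiber x :=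
  (J.tangentQ x).dualMap.restrict (p := J.LFiber x) (q := (J.TSinQ x).dualAnnihilator) (by
    intro α hα
    rw [Submodule.mem_dualAnnihilator]
    intro v hv
    exact (Submodule.mem_dualAnnihilator α).1 hα _ (Submodule.mem_map_of_mem hv))

/-- The pairing of the Lie algebra quotient bundle `(T_xS)^0` with its dual `T_xQ / T_xS`. -/
def pairing (x : X) (w : TangentSpace 𝓘(ℝ, EQ) (J.toQ x) ⧸ J.TSinQ x) :
    J.LQuotFiber x →ₗ[ℝ] ℝ :=
  (J.TSinQ x).dualCopairing.flip w

variable (P : PoissonStructure E Z) (g : Type*) [LieRing g] [LieAlgebra ℝ g]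

/-- The fibre at `x` of the Lie frame bundle: Lie algebra isomorphisms from `g` to the fibre of
`L_X`, whose Lie bracket is given by `[df_x, dh_x] = d{f, h}_x`. -/
def LieFrame (x : X) : Type _ :=
  {a : g ≃ₗ[ℝ] J.LFiber x // ∀ (ξ η : g) (f h : C^∞⟮𝓘(ℝ, E), Z; ℝ⟯),
    diffAt f (J.toZ x) = a ξ → diffAt h (J.toZ x) = a η →
      diffAt (P.bracket f h) (J.toZ x) = a ⁅ξ, η⁆}

variable {g} (c : LieSubalgebra ℝ g)

/-- The fibre at `x` of the constraint Lie frame bundle: Lie frames mapping `c` onto `(T_xQ)^0`. -/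
def ConstraintFrame (x : X) : Type _ :=
  {a : J.LieFrame P g x // ∀ ξ : g, (a.1 ξ).1 ∈ J.AFiber x ↔ ξ ∈ c}

variable {P c} {x : X}

/-- The right action of `N` on constraint Lie frames, `(a, n) ↦ a ∘ n`. -/
def ConstraintFrame.act (a : J.ConstraintFrame P c x) (n : autStab c) : J.ConstraintFrame P c x :=
  ⟨⟨(n : g ≃ₗ[ℝ] g).trans a.1.1, fun ξ η f h hf hh => by
      have hn : (n : g ≃ₗ[ℝ] g) ⁅ξ, η⁆ = ⁅(n : g ≃ₗ[ℝ] g) ξ, (n : g ≃ₗ[ℝ] g) η⁆ := n.2.2 ξ η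
      rw [LinearEquiv.trans_apply, hn]
      exact a.1.2 _ _ f h hf hh⟩,
    fun ξ => (a.2 _).trans (n.2.1 ξ)⟩

theorem ConstraintFrame.restrictL_eq_zero (a : J.ConstraintFrame P c x) {ξ : g} (hξ : ξ ∈ c) :
    J.restrictL x (a.1.1 ξ) = 0 := by
  have h : (a.1.1 ξ).1 ∈ (LinearMap.range (J.tangentQ x)).dualAnnihilator := (a.2 ξ).2 hξ
  apply Subtype.ext
  apply LinearMap.ext
  intro v
  exact (Submodule.mem_dualAnnihilator (a.1.1 ξ).1).1 h _ ⟨v, rfl⟩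

/-- The linear map `g/c → (T_xS)^0 ⊆ T_x^*Q` induced by a constraint Lie frame. -/
def ConstraintFrame.quotMap (a : J.ConstraintFrame P c x) :
    (g ⧸ c.toSubmodule) →ₗ[ℝ] J.LQuotFiber x :=
  let f : g →ₗ[ℝ] J.LQuotFiber x := J.restrictL x ∘ₗ a.1.1.toLinearMap
  c.toSubmodule.liftQ f (fun _ hξ => a.restrictL_eq_zero J hξ)

theorem ConstraintFrame.quotMap_act (a : J.ConstraintFrame P c x) (n : autStab c) :
    ConstraintFrame.quotMap J (a.act J n) =
      a.quotMap J ∘ₗ quotAct c.toSubmodule ⟨n, autStab_le_linStab c n.2⟩ := by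
  refine LinearMap.ext fun ξ => ?_
  induction ξ using Submodule.Quotient.induction_on
  rfl

theorem ConstraintFrame.act_act (a : J.ConstraintFrame P c x) (n m : autStab c) :
    ConstraintFrame.act J (a.act J n) m = a.act J (n * m) := rfl

theorem ConstraintFrame.toSym_act (a : J.ConstraintFrame P c x) (n : autStab c)
    (s : SymmetricAlgebra ℝ (g ⧸ c.toSubmodule)) :
    symMap (ConstraintFrame.quotMap J (a.act J n)) s =
      symMap (a.quotMap J) (symQuotAct c.toSubmodule ⟨n, autStab_le_linStab c n.2⟩ s) := by
  rw [ConstraintFrame.quotMap_act, symMap_comp]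
  rfl

variable [FiniteDimensional ℝ g] (P c x)

/-- The fibre at `x` of the `i`-th quotient principal bundle, the quotient of the constraint Lie
frame bundle by `K_i`. -/
def QuotFrame (i : ℕ) : Type _ :=
  Quot fun a b : J.ConstraintFrame P c x => ∃ k ∈ invKer c i, b = a.act J k

variable {P c x}

/-- The right action of `N / K_i` on the `i`-th quotient principal bundle. -/
def QuotFrame.act {i : ℕ} (r : J.QuotFrame P c x i) (ν : QuotGroup c i) : J.QuotFrame P c x i :=
  Quotient.liftOn ν
    (fun n => Quot.map (fun a => a.act J n) (fun a b h => by
      obtain ⟨k, hk, rfl⟩ := h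
      refine ⟨n⁻¹ * k * n, ?_, ?_⟩
      · simpa using (inferInstance : (invKer c i).Normal).conj_mem k hk n⁻¹
      · simp only [ConstraintFrame.act_act]
        group) r)
    (fun n n' h => by
      have hk : n⁻¹ * n' ∈ invKer c i := QuotientGroup.leftRel_apply.1 h
      induction r using Quot.ind with
      | mk a =>
        refine Quot.sound ⟨n⁻¹ * n', hk, ?_⟩
        rw [ConstraintFrame.act_act, mul_inv_cancel_left])

variable (P c x)

/-- The fibre at `x` of the `i`-th associated bundle, the quotient of `R_i × S^i(g/c)^C` by
`N_i = N / K_i`, where `R_i` is the `i`-th quotient principal bundle. -/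
def AssocFiber (i : ℕ) : Type _ :=
  Quot fun p q : J.QuotFrame P c x i × symInv c i =>
    ∃ ν : QuotGroup c i, p.1 = q.1.act J ν ∧ q.2 = quotRep c i ν p.2

/-- The fibre at `x` of the quotient of `R_1 × N_g(c)/c` by `N_1 = N / K_1`. -/
def RedAssocFiber : Type _ :=
  Quot fun p q : J.QuotFrame P c x 1 × redLieAlg c =>
    ∃ n : autStab c, p.1 = q.1.act J (QuotientGroup.mk n) ∧
      (q.2 : g ⧸ c.toSubmodule) =
        quotAct c.toSubmodule ⟨n, autStab_le_linStab c n.2⟩ p.2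

variable {P c x}

/-- The embedding of the `i`-th associated bundle into `S^i` of the Lie algebra quotient bundle,
given by `[[a], s] ↦ S^i(a)(s)`. -/
def AssocFiber.toSym {i : ℕ} : J.AssocFiber P c x i → SymmetricAlgebra ℝ (J.LQuotFiber x) :=
  Quot.lift (fun p => Quot.liftOn p.1 (fun a => symMap (a.quotMap J) p.2.1) (by
      rintro a _ ⟨k, hk, rfl⟩
      have h := congrArg Subtype.val (LinearMap.congr_fun hk p.2)
      exact (((a.toSym_act J k p.2.1).trans (congrArg _ h))).symm)) (by
    rintro ⟨r, s⟩ ⟨r', s'⟩ ⟨ν, hr, hs⟩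
    obtain rfl : r = r'.act J ν := hr
    obtain rfl : s' = quotRep c i ν s := hs
    induction ν using QuotientGroup.induction_on with
    | H n =>
      induction r' using Quot.ind with
      | mk a => exact a.toSym_act J n s.1)

end Frames

section Functions

/-- The polynomial function on the fibre `T_xQ / T_xS` defined by an element of the symmetric
algebra of its dual `(T_xS)^0 ⊆ T_x^*Q`. -/
def evalSym (x : X) (s : SymmetricAlgebra ℝ (J.LQuotFiber x))
    (w : TangentSpace 𝓘(ℝ, EQ) (J.toQ x) ⧸ J.TSinQ x) : ℝ :=
  SymmetricAlgebra.lift (J.pairing x w) s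

/-- The function on `TQ|_X / TS|_X` defined by a (not necessarily continuous) section of the bundle
of symmetric algebras. -/
def sectionFun (s : ∀ x, SymmetricAlgebra ℝ (J.LQuotFiber x)) (w : J.LQuotDual) : ℝ :=
  J.evalSym w.1 (s w.1) w.2

variable [IsManifold 𝓘(ℝ, EQ) ∞ Q]

/-- The vertically polynomial smooth functions on `TQ|_X / TS|_X`. -/
def vertPoly : Set (J.LQuotDual → ℝ) :=
  {h | NormalBundle.IsSmooth h ∧ ∃ (d : ℕ) (s : ∀ (_ : ℕ) (x : X),
    SymmetricAlgebra ℝ (J.LQuotFiber x)), (∀ i x, s i x ∈ symPow (J.LQuotFiber x) i) ∧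
      h = ∑ i ∈ Finset.range (d + 1), J.sectionFun (s i)}

/-- The functions on `TQ|_X / TS|_X` given by smooth sections of the Lie algebra quotient bundle. -/
def linFun : Set (J.LQuotDual → ℝ) :=
  {h | NormalBundle.IsSmooth h ∧ ∃ s : ∀ x, J.LQuotFiber x,
    h = J.sectionFun fun x => SymmetricAlgebra.ι ℝ _ (s x)}

variable (P : PoissonStructure E Z) {g : Type*} [LieRing g] [LieAlgebra ℝ g]
  [FiniteDimensional ℝ g] (c : LieSubalgebra ℝ g)

/-- The functions on `TQ|_X / TS|_X` given by smooth sections of the `i`-th associated bundle. -/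
def assocFun (i : ℕ) : Set (J.LQuotDual → ℝ) :=
  {h | NormalBundle.IsSmooth h ∧ ∃ σ : ∀ x, J.AssocFiber P c x i,
    h = J.sectionFun fun x => (σ x).toSym J}

end Functions

end Inclusions

end SternbergWeinstein

end

open SternbergWeinstein

/-! Fix `x` in `X` and a constraint frame `a`, which identifies `g/c` with the fibre of the Lie
algebra quotient bundle. A fibrewise polynomial function then becomes, at `x`, an element `s'` of
`S(g/c)`, read as a polynomial on the dual of `g/c`. Everything reduces to computing the bracket of
an extension `F` of such a function with a constraint `G` at a point of `Q'`.

Write `dF = d(\bar{df} + τ^*k)` and `dG = d(\bar{dh} + τ^*m)` at the point given by a vector `v`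
tangent to `Q`. As `F` restricted to `Q'` is pulled back from `TQ/TS`, the covector `df` kills `TS`;
as `G` vanishes on `Q'`, the covector `dh` kills `TQ`. So `df = a ξ` and `dh = a η` with `η ∈ c`.
Covectors killing `TS` lie in the kernel of the bivector (`LieFrame.bracket_eq_zero`), so the terms
with `k` and `m` vanish and only `d{f,h}(v) = (a [ξ, η])(v)` remains. With `w` the linear form on
`g/c` given by `v`, this is minus the derivative of `s'` at `w` in the direction `w ∘ ad η`
(`bracket_jets_eq`). It does not depend on the extension or on the jets.

Every `η ∈ c` comes from a constraint (`exists_constraint`), and every smooth function on `Q'`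
extends (`exists_smooth_extension`). Hence reducedness means exactly that all these derivatives
vanish, i.e. that `s'` is infinitesimally invariant (`mem_reducedAlgebra`). Integrating along `exp(t
ad η)` turns this into `Ad(C)`-invariance (`isInfInvariant_iff`).

Homogeneous components are recovered by rescaling the argument by `0, …, d` and inverting a
Vandermonde matrix; this passes both smoothness and invariance from a sum to its parts. In degree
one, invariance of the class of `v` says `[ξ, v] ∈ c` for all `ξ ∈ c`, so `v` lies in the idealizer.
-/

namespace SternbergWeinstein

/-! ### Differential calculus of polynomial functions given by a symmetric algebra -/

section SymmetricAlgebraDerivative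

variable {V : Type*} [AddCommGroup V] [Module ℝ V]

/-- The linear map `v ↦ w v + ε w' v` to the dual numbers. -/
noncomputable def dualJet (w w' : V →ₗ[ℝ] ℝ) : V →ₗ[ℝ] TrivSqZeroExt ℝ ℝ :=
  (TrivSqZeroExt.inlAlgHom ℝ ℝ ℝ).toLinearMap ∘ₗ w + TrivSqZeroExt.inrHom ℝ ℝ ∘ₗ w'

/-- The derivative at `w`, in the direction `w'`, of the polynomial function on the dual of `V`
defined by an element of the symmetric algebra of `V`. -/
noncomputable def symDeriv (s : SymmetricAlgebra ℝ V) (w w' : V →ₗ[ℝ] ℝ) : ℝ :=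
  (SymmetricAlgebra.lift (dualJet w w') s).snd

theorem fst_dualJet (w w' : V →ₗ[ℝ] ℝ) (v : V) : (dualJet w w' v).fst = w v := by
  simp [dualJet]

theorem snd_dualJet (w w' : V →ₗ[ℝ] ℝ) (v : V) : (dualJet w w' v).snd = w' v := by
  simp [dualJet]

theorem fst_lift_dualJet (s : SymmetricAlgebra ℝ V) (w w' : V →ₗ[ℝ] ℝ) :
    (SymmetricAlgebra.lift (dualJet w w') s).fst = SymmetricAlgebra.lift w s := by
  have h : (TrivSqZeroExt.fstHom ℝ ℝ ℝ).comp (SymmetricAlgebra.lift (dualJet w w')) =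
      SymmetricAlgebra.lift w := by
    apply SymmetricAlgebra.algHom_ext
    ext v
    simp [fst_dualJet]
  exact congrArg (fun f => f s) h

/-- Evaluation in the dual numbers is multiplicative, so its second component obeys the Leibniz
rule, and it suffices to compare on generators. Only pointwise differentiability of the curve is
needed, so no topology on `V` enters. -/
theorem hasDerivAt_lift (s : SymmetricAlgebra ℝ V) {w : ℝ → V →ₗ[ℝ] ℝ} {w' : V →ₗ[ℝ] ℝ} {t : ℝ}
    (h : ∀ v, HasDerivAt (fun τ => w τ v) (w' v) t) :
    HasDerivAt (fun τ => SymmetricAlgebra.lift (w τ) s) (symDeriv s (w t) w') t := by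
  induction s using SymmetricAlgebra.induction with
  | algebraMap r =>
    have : symDeriv (algebraMap ℝ (SymmetricAlgebra ℝ V) r) (w t) w' = 0 := by
      simp [symDeriv, TrivSqZeroExt.algebraMap_eq_inl']
    rw [this]
    simpa using hasDerivAt_const t r
  | ι v => simpa [symDeriv, snd_dualJet] using h v
  | mul a b ha hb =>
    refine ((ha.mul hb).congr_deriv ?_).congr_of_eventuallyEq (.of_eq (by ext; simp))
    simp [symDeriv, fst_lift_dualJet, mul_comm, add_comm]
  | add a b ha hb =>
    refine ((ha.add hb).congr_deriv ?_).congr_of_eventuallyEq (.of_eq (by ext; simp))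
    simp [symDeriv]

theorem lift_symMap {W A : Type*} [AddCommGroup W] [Module ℝ W] [CommRing A] [Algebra ℝ A]
    (f : V →ₗ[ℝ] W) (w : W →ₗ[ℝ] A) (s : SymmetricAlgebra ℝ V) :
    SymmetricAlgebra.lift w (symMap f s) = SymmetricAlgebra.lift (w ∘ₗ f) s := by
  have h : (SymmetricAlgebra.lift w).comp (symMap f) = SymmetricAlgebra.lift (w ∘ₗ f) := by
    apply SymmetricAlgebra.algHom_ext
    ext v
    simp [symMap]
  exact congrArg (fun f => f s) h

theorem lift_smul_of_mem_symPow {A : Type*} [CommRing A] [Algebra ℝ A] (f : V →ₗ[ℝ] A) (r : ℝ)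
    {i : ℕ} {s : SymmetricAlgebra ℝ V} (hs : s ∈ symPow V i) :
    SymmetricAlgebra.lift (r • f) s = r ^ i • SymmetricAlgebra.lift f s := by
  induction hs using Submodule.pow_induction_on_left' with
  | algebraMap a => simp
  | add x y i hx hy h1 h2 => simp [h1, h2]
  | mem_mul m hm i x hx h =>
    obtain ⟨v, rfl⟩ := hm
    rw [map_mul, map_mul, h]
    simp [pow_succ, mul_smul]

/-- Scaling both the point and the direction scales the whole dual-number valued map, so the
exponent is `i` and not `i - 1`. -/
theorem symDeriv_smul_of_mem_symPow (w w' : V →ₗ[ℝ] ℝ) (r : ℝ) {i : ℕ}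
    {s : SymmetricAlgebra ℝ V} (hs : s ∈ symPow V i) :
    symDeriv s (r • w) (r • w') = r ^ i * symDeriv s w w' := by
  have h : dualJet (r • w) (r • w') = r • dualJet w w' := by
    simp [dualJet, LinearMap.comp_smul]
  rw [symDeriv, h, lift_smul_of_mem_symPow _ r hs]
  simp [symDeriv]

theorem symDeriv_sum {ι : Type*} (I : Finset ι) (s : ι → SymmetricAlgebra ℝ V)
    (w w' : V →ₗ[ℝ] ℝ) :
    symDeriv (∑ i ∈ I, s i) w w' = ∑ i ∈ I, symDeriv (s i) w w' := by
  simp [symDeriv, TrivSqZeroExt.snd_sum]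

/-- In a basis this is the fact that a polynomial over an infinite field is determined by its
values. -/
theorem eq_zero_of_forall_lift_eq_zero [FiniteDimensional ℝ V] (s : SymmetricAlgebra ℝ V)
    (h : ∀ w : V →ₗ[ℝ] ℝ, SymmetricAlgebra.lift w s = 0) : s = 0 := by
  let b := Module.finBasis ℝ V
  let Φ := SymmetricAlgebra.equivMvPolynomial b
  apply Φ.injective
  rw [map_zero]
  apply MvPolynomial.funext
  intro x
  have h1 : (MvPolynomial.aeval x).comp Φ.toAlgHom =
      SymmetricAlgebra.lift (b.constr ℝ x) := by
    apply SymmetricAlgebra.algHom_ext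
    apply b.ext
    intro i
    simp [Φ, b.constr_basis]
  have h2 := congrArg (fun f => f s) h1
  simp only [h] at h2
  simpa [MvPolynomial.aeval_eq_eval] using h2

/-- The coefficients are a row of the inverse of the Vandermonde matrix with nodes `0, …, d`. They
extract the degree `i` part of a polynomial expression from its values at the rescalings by these
nodes. -/
theorem exists_separating_coeff (d i : ℕ) (hi : i < d + 1) :
    ∃ C : Fin (d + 1) → ℝ, ∀ k < d + 1,
      ∑ j, C j * ((j : ℕ) : ℝ) ^ k = if k = i then 1 else 0 := by
  let M : Matrix (Fin (d + 1)) (Fin (d + 1)) ℝ := Matrix.vandermonde fun j => ((j : ℕ) : ℝ)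
  have hM : IsUnit M.det := by
    rw [isUnit_iff_ne_zero, Matrix.det_vandermonde_ne_zero_iff]
    intro a b hab
    exact Fin.ext (Nat.cast_injective hab)
  refine ⟨Matrix.vecMul (Pi.single ⟨i, hi⟩ 1) M⁻¹, fun k hk => ?_⟩
  have h1 : Matrix.vecMul (Matrix.vecMul (Pi.single ⟨i, hi⟩ 1) M⁻¹) M =
      Pi.single ⟨i, hi⟩ 1 := by
    rw [Matrix.vecMul_vecMul, Matrix.nonsing_inv_mul _ hM, Matrix.vecMul_one]
  have h2 := congrFun h1 ⟨k, hk⟩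
  simpa [Matrix.vecMul, dotProduct, M, Matrix.vandermonde_apply, Pi.single_apply] using h2

end SymmetricAlgebraDerivative

/-! ### One-parameter groups in a finite-dimensional space without a chosen norm -/

section Exponential

variable {V : Type*} [AddCommGroup V] [Module ℝ V] [FiniteDimensional ℝ V]

theorem IsExp.unique {A : Module.End ℝ V} {e e' : V ≃ₗ[ℝ] V} (h : IsExp A e) (h' : IsExp A e') :
    e = e' := by
  ext v
  rw [← sub_eq_zero, ← Module.forall_dual_apply_eq_zero_iff ℝ]
  intro l
  rw [map_sub, (h v l).unique (h' v l), sub_self]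

/-- A basis carries `End V` to the Banach algebra of continuous endomorphisms of `ℝ^n`, where the
exponential and its derivative are available. Series and derivative return through the functional `T
↦ l (T v)`, which is continuous by finite dimension. -/
theorem exists_isExp_curve (A : Module.End ℝ V) :
    ∃ e : ℝ → V ≃ₗ[ℝ] V, (∀ t, IsExp (t • A) (e t)) ∧ (∀ v, e 0 v = v) ∧
      ∀ t v (l : Module.Dual ℝ V), HasDerivAt (fun τ => l (e τ v)) (l (e t (A v))) t := by
  let n := Module.finrank ℝ V
  let Φ : Module.End ℝ V ≃ₐ[ℝ] ((Fin n → ℝ) →L[ℝ] (Fin n → ℝ)) :=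
    ((Module.finBasis ℝ V).equivFun.conjAlgEquiv ℝ).trans
      (Module.End.toContinuousLinearMap (Fin n → ℝ))
  let ex : ℝ → Module.End ℝ V := fun t => Φ.symm (NormedSpace.exp (t • Φ A))
  have hmul : ∀ s t, ex (s + t) = ex s * ex t := fun s t => by
    simp only [ex]
    let _ : NormedAlgebra ℚ ((Fin n → ℝ) →L[ℝ] (Fin n → ℝ)) :=
      NormedAlgebra.restrictScalars ℚ ℝ _
    rw [← map_mul, ← NormedSpace.exp_add_of_commute, ← add_smul]
    exact (Commute.refl _).smul_left s |>.smul_right t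
  have h0 : ex 0 = 1 := by simp [ex]
  let e : ℝ → V ≃ₗ[ℝ] V := fun t => LinearEquiv.ofLinearMap (ex t) (ex (-t))
    (by rw [← Module.End.mul_eq_comp, ← hmul, add_neg_cancel, h0]; rfl)
    (by rw [← Module.End.mul_eq_comp, ← hmul, neg_add_cancel, h0]; rfl)
  let φ : V → Module.Dual ℝ V → ((Fin n → ℝ) →L[ℝ] (Fin n → ℝ)) →L[ℝ] ℝ := fun v l =>
    LinearMap.toContinuousLinearMap (l ∘ₗ LinearMap.applyₗ v ∘ₗ Φ.symm.toLinearMap)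
  have hφ : ∀ v l t, φ v l (NormedSpace.exp (t • Φ A)) = l (e t v) := fun v l t => rfl
  refine ⟨e, fun t v l => ?_, fun v => by simp [e, h0], fun t v l => ?_⟩
  · have h := (NormedSpace.exp_series_hasSum_exp' (𝕂 := ℝ) (t • Φ A)).mapL (φ v l)
    rw [hφ] at h
    convert h using 2 with k
    rw [map_smul, smul_eq_mul]
    congr 1
    change _ = l (Φ.symm ((t • Φ A) ^ k) v)
    rw [map_pow, map_smul, AlgEquiv.symm_apply_apply]
  · have h := (φ v l).hasFDerivAt.comp_hasDerivAt t (hasDerivAt_exp_smul_const (𝕂 := ℝ) (Φ A) t)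
    have h1 : φ v l (NormedSpace.exp (t • Φ A) * Φ A) = l (e t (A v)) := by
      change l (Φ.symm (NormedSpace.exp (t • Φ A) * Φ A) v) = _
      rw [map_mul, AlgEquiv.symm_apply_apply]
      rfl
    rw [h1] at h
    exact h

end Exponential

/-! ### Invariance under `Ad(C)` and its infinitesimal form -/

section Invariants

variable {g : Type*} [LieRing g] [LieAlgebra ℝ g]

/-- The action of `ξ ∈ c` on `g / c`. -/
def adQuot (c : LieSubalgebra ℝ g) (ξ : c) : Module.End ℝ (g ⧸ c.toSubmodule) :=
  c.toSubmodule.mapQ c.toSubmodule (LieAlgebra.ad ℝ g (ξ : g))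
    (fun _ hv => c.lie_mem ξ.2 hv)

/-- Infinitesimal `Ad(C)`-invariance of the polynomial function on the dual of `g / c` defined by
an element of the symmetric algebra. -/
def IsInfInvariant (c : LieSubalgebra ℝ g) (s : SymmetricAlgebra ℝ (g ⧸ c.toSubmodule)) : Prop :=
  ∀ (ξ : c) (w : (g ⧸ c.toSubmodule) →ₗ[ℝ] ℝ), symDeriv s w (w ∘ₗ adQuot c ξ) = 0

/-- The velocity at time `t` has the form tested by `IsInfInvariant`, at the moved point `w ∘ e t`.
Infinitesimal invariance at all points therefore makes the curve stationary at all times. -/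
theorem hasDerivAt_lift_quotAct (c : LieSubalgebra ℝ g) (ξ : c)
    {e : ℝ → g ≃ₗ[ℝ] g} (he : ∀ t, e t ∈ linStab c.toSubmodule)
    (h : ∀ t v (l : Module.Dual ℝ g),
      HasDerivAt (fun τ => l (e τ v)) (l (e t (LieAlgebra.ad ℝ g (ξ : g) v))) t)
    (s : SymmetricAlgebra ℝ (g ⧸ c.toSubmodule)) (w : (g ⧸ c.toSubmodule) →ₗ[ℝ] ℝ) (t : ℝ) :
    HasDerivAt (fun τ => SymmetricAlgebra.lift w (symQuotAct c.toSubmodule ⟨e τ, he τ⟩ s))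
      (symDeriv s (w ∘ₗ quotAct c.toSubmodule ⟨e t, he t⟩)
        ((w ∘ₗ quotAct c.toSubmodule ⟨e t, he t⟩) ∘ₗ adQuot c ξ)) t := by
  have h1 : ∀ τ, SymmetricAlgebra.lift w (symQuotAct c.toSubmodule ⟨e τ, he τ⟩ s) =
      SymmetricAlgebra.lift (w ∘ₗ quotAct c.toSubmodule ⟨e τ, he τ⟩) s :=
    fun τ => lift_symMap _ _ _
  simp only [h1]
  refine hasDerivAt_lift (w := fun τ => w ∘ₗ quotAct c.toSubmodule ⟨e τ, he τ⟩) s fun v => ?_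
  induction v using Submodule.Quotient.induction_on with
  | H v => exact h t v (w ∘ₗ c.toSubmodule.mkQ)

variable [FiniteDimensional ℝ g]

/-- From left to right, `s` is constant along `exp(t ad ξ)`, hence fixed by the generators of
`adGroup c` and so by the whole group. Conversely, the flow lies in the group, and differentiating
the constant orbit at time `0` gives the infinitesimal condition. -/
theorem isInfInvariant_iff (c : LieSubalgebra ℝ g) (s : SymmetricAlgebra ℝ (g ⧸ c.toSubmodule)) :
    IsInfInvariant c s ↔ ∀ (u : g ≃ₗ[ℝ] g) (hu : u ∈ adGroup c),
        symQuotAct c.toSubmodule ⟨u, adGroup_le_linStab c hu⟩ s = s := by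
  have key : ∀ ξ : c, ∃ (e : ℝ → g ≃ₗ[ℝ] g) (he : ∀ t, e t ∈ adGroup c),
      IsExp (LieAlgebra.ad ℝ g (ξ : g)) (e 1) ∧ (∀ v, e 0 v = v) ∧
      ∀ t v (l : Module.Dual ℝ g),
        HasDerivAt (fun τ => l (e τ v)) (l (e t (LieAlgebra.ad ℝ g (ξ : g) v))) t := by
    intro ξ
    obtain ⟨e, h1, h2, h3⟩ := exists_isExp_curve (LieAlgebra.ad ℝ g (ξ : g))
    refine ⟨e, fun t => Subgroup.subset_closure ⟨t • (ξ : g), c.smul_mem t ξ.2, ?_⟩, ?_, h2, h3⟩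
    · rw [map_smul]; exact h1 t
    · simpa using h1 1
  constructor
  · intro hs
    -- The stabilizer of `s` is a subgroup, so it is enough that it contains the generators.
    let H : Subgroup (linStab c.toSubmodule) :=
      { carrier := {u | symQuotAct c.toSubmodule u s = s}
        mul_mem' := fun {a b} ha hb => by
          change symQuotAct c.toSubmodule (a * b) s = s
          rw [map_mul, Module.End.mul_apply, hb, ha]
        one_mem' := by
          change symQuotAct c.toSubmodule 1 s = s
          rw [map_one, Module.End.one_apply]
        inv_mem' := fun {a} ha => by
          change symQuotAct c.toSubmodule a⁻¹ s = s
          conv_lhs => rw [← show symQuotAct c.toSubmodule a s = s from ha]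
          rw [← Module.End.mul_apply, ← map_mul, inv_mul_cancel, map_one, Module.End.one_apply] }
    have hle : adGroup c ≤ H.map (linStab c.toSubmodule).subtype := by
      rw [adGroup, Subgroup.closure_le]
      rintro u ⟨ξ, hξ, hu⟩
      obtain ⟨e, he, h1, h0, hd⟩ := key ⟨ξ, hξ⟩
      obtain rfl : u = e 1 := hu.unique h1
      refine ⟨⟨e 1, adGroup_le_linStab c (he 1)⟩, ?_, rfl⟩
      change symQuotAct c.toSubmodule _ s = s
      rw [← sub_eq_zero]
      refine eq_zero_of_forall_lift_eq_zero _ fun w => ?_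
      have h := hasDerivAt_lift_quotAct c ⟨ξ, hξ⟩ (fun t => adGroup_le_linStab c (he t)) hd s w
      have hc := is_const_of_deriv_eq_zero (fun t => (h t).differentiableAt)
        (fun t => (h t).deriv.trans (hs _ _)) 1 0
      have h1 : (⟨e 0, adGroup_le_linStab c (he 0)⟩ : linStab c.toSubmodule) = 1 :=
        Subtype.ext (LinearEquiv.ext h0)
      rw [map_sub, hc, h1, map_one, Module.End.one_apply, sub_self]
    intro u hu
    obtain ⟨v, hv, rfl⟩ := hle hu
    exact hv
  · intro hs ξ w
    obtain ⟨e, he, -, h0, hd⟩ := key ξ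
    have h := hasDerivAt_lift_quotAct c ξ (fun t => adGroup_le_linStab c (he t)) hd s w 0
    simp only [hs _ (he _)] at h
    have h1 : w ∘ₗ quotAct c.toSubmodule ⟨e 0, adGroup_le_linStab c (he 0)⟩ = w := by
      refine LinearMap.ext fun v => ?_
      induction v using Submodule.Quotient.induction_on with
      | H v => exact congrArg (fun v => w (Submodule.Quotient.mk v)) (h0 v)
    rw [h1] at h
    exact h.unique (hasDerivAt_const _ _)

end Invariants
end SternbergWeinstein

namespace SternbergWeinstein

/-! ### Smooth local left inverses of immersions -/

section Retractions

variable {EM M EN N : Type*} [NormedAddCommGroup EM] [NormedSpace ℝ EM] [TopologicalSpace M]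
  [ChartedSpace EM M] [NormedAddCommGroup EN] [NormedSpace ℝ EN] [TopologicalSpace N]
  [ChartedSpace EN N]

/-- `r` is a smooth left inverse, near `m`, of the map `f`. -/
structure IsLocalRetraction (f : M → N) (m : M) (U : Set N) (r : N → M) : Prop where
  isOpen : IsOpen U
  mem : f m ∈ U
  contMDiffOn : ContMDiffOn 𝓘(ℝ, EN) 𝓘(ℝ, EM) ∞ r U
  eventually : ∀ᶠ m' in 𝓝 m, r (f m') = m'

/-- In the charts of the immersion `f` reads `u ↦ (u, 0)`, so projection to the first factor,
conjugated by the charts, is a left inverse. -/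
theorem exists_isLocalRetraction [IsManifold 𝓘(ℝ, EM) ∞ M] [IsManifold 𝓘(ℝ, EN) ∞ N]
    {f : M → N} {m : M}
    (h : Manifold.IsImmersionAt 𝓘(ℝ, EM) 𝓘(ℝ, EN) ∞ f m) :
    ∃ U r, IsLocalRetraction (EM := EM) (EN := EN) f m U r := by
  let L : EN →L[ℝ] EM := (ContinuousLinearMap.fst ℝ EM h.complement) ∘L
    (h.equiv.symm : EN →L[ℝ] EM × h.complement)
  have hw : ∀ m' ∈ h.domChart.source, L (h.codChart (f m')) = h.domChart m' := by
    intro m' hm'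
    have h0 : h.domChart m' ∈ (h.domChart.extend 𝓘(ℝ, EM)).target := by
      simpa using h.domChart.map_source hm'
    have h1 := h.writtenInCharts h0
    simp only [Function.comp_apply, OpenPartialHomeomorph.extend_coe,
      OpenPartialHomeomorph.extend_coe_symm, modelWithCornersSelf_coe, id_eq,
      modelWithCornersSelf_coe_symm, h.domChart.left_inv hm'] at h1
    simp [L, h1]
  refine ⟨h.codChart.source ∩ h.codChart ⁻¹' (L ⁻¹' h.domChart.target),
    fun y => h.domChart.symm (L (h.codChart y)), ?_, ?_, ?_, ?_⟩
  · exact h.codChart.isOpen_inter_preimage (h.domChart.open_target.preimage L.continuous)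
  · refine ⟨h.mem_codChart_source, ?_⟩
    simp only [Set.mem_preimage]
    rw [hw _ h.mem_domChart_source]
    exact h.domChart.map_source h.mem_domChart_source
  · refine (contMDiffOn_symm_of_mem_maximalAtlas h.domChart_mem_maximalAtlas).comp
      (t := h.domChart.target) ?_ fun y hy => hy.2
    exact L.contMDiff.comp_contMDiffOn
      ((contMDiffOn_of_mem_maximalAtlas h.codChart_mem_maximalAtlas).mono Set.inter_subset_left)
  · filter_upwards [h.domChart.open_source.mem_nhds h.mem_domChart_source] with m' hm'
    rw [hw m' hm', h.domChart.left_inv hm']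

theorem IsLocalRetraction.eventually_isLocalRetraction {f : M → N} {m : M} {U : Set N} {r : N → M}
    (h : IsLocalRetraction (EM := EM) (EN := EN) f m U r) (hf : ContinuousAt f m) :
    ∀ᶠ m' in 𝓝 m, IsLocalRetraction (EM := EM) (EN := EN) f m' U r := by
  filter_upwards [h.eventually.eventually_nhds, hf.eventually (h.isOpen.mem_nhds h.mem)]
    with m' h1 h2
  exact ⟨h.isOpen, h2, h.contMDiffOn, h1⟩

theorem IsLocalRetraction.comp {EZ Z : Type*} [NormedAddCommGroup EZ] [NormedSpace ℝ EZ]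
    [TopologicalSpace Z] [ChartedSpace EZ Z] {f : M → N} {k : N → Z} {m : M} {U : Set N}
    {V : Set Z} {r : N → M} {q : Z → N} (hk : IsLocalRetraction (EM := EN) (EN := EZ) k (f m) V q)
    (hf : IsLocalRetraction (EM := EM) (EN := EN) f m U r) (hc : ContinuousAt f m) :
    IsLocalRetraction (EM := EM) (EN := EZ) (k ∘ f) m (V ∩ q ⁻¹' U) (r ∘ q) where
  isOpen := hk.contMDiffOn.continuousOn.isOpen_inter_preimage hk.isOpen hf.isOpen
  mem := ⟨hk.mem, by
    simp only [Function.comp_apply, Set.mem_preimage]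
    rw [hk.eventually.self_of_nhds]
    exact hf.mem⟩
  contMDiffOn := hf.contMDiffOn.comp (hk.contMDiffOn.mono Set.inter_subset_left) fun y hy => hy.2
  eventually := by
    filter_upwards [hf.eventually, hc.eventually hk.eventually] with m' h1 h2
    simp [h1, h2]

theorem IsLocalRetraction.mfderiv_apply {f : M → N} {m : M} {U : Set N} {r : N → M}
    (h : IsLocalRetraction (EM := EM) (EN := EN) f m U r)
    (hf : MDifferentiableAt 𝓘(ℝ, EM) 𝓘(ℝ, EN) f m) (v : TangentSpace 𝓘(ℝ, EM) m) :
    (mfderiv 𝓘(ℝ, EN) 𝓘(ℝ, EM) r (f m) (mfderiv 𝓘(ℝ, EM) 𝓘(ℝ, EN) f m v) : EM) = v := by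
  have h1 : MDifferentiableAt 𝓘(ℝ, EN) 𝓘(ℝ, EM) r (f m) :=
    ((h.contMDiffOn _ h.mem).contMDiffAt (h.isOpen.mem_nhds h.mem)).mdifferentiableAt (by simp)
  have h2 := mfderiv_comp m h1 hf
  have h3 : r ∘ f =ᶠ[𝓝 m] id := h.eventually
  rw [h3.mfderiv_eq, mfderiv_id] at h2
  exact (congrArg (fun L => L v) h2).symm

end Retractions

/-! ### Global functions with prescribed local behaviour -/

section Extensions

variable {E Z : Type*} [NormedAddCommGroup E] [NormedSpace ℝ E] [FiniteDimensional ℝ E]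
  [TopologicalSpace Z] [T2Space Z] [ChartedSpace E Z] [IsManifold 𝓘(ℝ, E) ∞ Z]

/-- Multiply by a bump function supported in `U`. The product vanishes wherever `u` does, which is
used to preserve vanishing along submanifolds. -/
theorem exists_smooth_germ {U : Set Z} (hU : IsOpen U) {z : Z} (hz : z ∈ U) {u : Z → ℝ}
    (hu : ContMDiffOn 𝓘(ℝ, E) 𝓘(ℝ, ℝ) ∞ u U) :
    ∃ f : C^∞⟮𝓘(ℝ, E), Z; ℝ⟯, f =ᶠ[𝓝 z] u ∧ (∀ y ∉ U, f y = 0) ∧ ∀ y, u y = 0 → f y = 0 := by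
  obtain ⟨χ, -, hχ⟩ := (SmoothBumpFunction.nhds_basis_tsupport (I := 𝓘(ℝ, E)) z).mem_iff.1
    (hU.mem_nhds hz)
  refine ⟨⟨fun y => χ y • u y, contMDiff_of_tsupport fun y hy => ?_⟩, ?_, ?_, ?_⟩
  · have hy' : y ∈ U := hχ (closure_mono (Function.support_smul_subset_left _ _) hy)
    exact χ.contMDiffAt.smul ((hu y hy').contMDiffAt (hU.mem_nhds hy'))
  · filter_upwards [χ.eventuallyEq_one] with y hy
    change χ y • u y = u y
    rw [hy, Pi.one_apply, one_smul]
  · intro y hy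
    change χ y • u y = 0
    rw [image_eq_zero_of_notMem_tsupport fun h => hy (hχ h), zero_smul]
  · intro y hy
    change χ y • u y = 0
    rw [hy, smul_zero]

/-- Apply `α` to the chart centred at `z`, whose differential at `z` is the identity, and globalize
the germ. -/
theorem exists_smooth_mfderiv_eq (z : Z) (α : Module.Dual ℝ (TangentSpace 𝓘(ℝ, E) z)) :
    ∃ f : C^∞⟮𝓘(ℝ, E), Z; ℝ⟯, f z = 0 ∧ diffAt f z = α := by
  let a : E →L[ℝ] ℝ := LinearMap.toContinuousLinearMap (α : E →ₗ[ℝ] ℝ)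
  let u : Z → ℝ := fun y => a (extChartAt 𝓘(ℝ, E) z y - extChartAt 𝓘(ℝ, E) z z)
  have hu : ContMDiffOn 𝓘(ℝ, E) 𝓘(ℝ, ℝ) ∞ u (chartAt E z).source := by
    exact a.contMDiff.comp_contMDiffOn (contMDiffOn_extChartAt.sub contMDiffOn_const)
  obtain ⟨f, hf, -, h0⟩ := exists_smooth_germ (chartAt E z).open_source (mem_chart_source E z) hu
  refine ⟨f, h0 z (by simp [u]), ?_⟩
  have h1 : HasMFDerivAt 𝓘(ℝ, E) 𝓘(ℝ, E) (extChartAt 𝓘(ℝ, E) z) z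
      (ContinuousLinearMap.id ℝ _) := by
    have h := (mdifferentiableAt_extChartAt (I := 𝓘(ℝ, E)) (mem_chart_source E z)).hasMFDerivAt
    rwa [mfderiv_extChartAt_self] at h
  have h2 : u = (fun w => a (w - extChartAt 𝓘(ℝ, E) z z)) ∘ (extChartAt 𝓘(ℝ, E) z) := rfl
  have h3 : HasFDerivAt (fun w => a (w - extChartAt 𝓘(ℝ, E) z z)) a
      (extChartAt 𝓘(ℝ, E) z z) :=
    a.hasFDerivAt.comp _ ((hasFDerivAt_id _).sub_const _)
  have h4 := h3.hasMFDerivAt.comp z h1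
  rw [← h2] at h4
  rw [diffAt, hf.mfderiv_eq, h4.mfderiv]
  rfl

variable {EM M : Type*} [NormedAddCommGroup EM] [NormedSpace ℝ EM] [TopologicalSpace M]
  [ChartedSpace EM M]

/-- A covector vanishing on the tangent space of an immersed manifold is the differential of a
function vanishing on a neighbourhood of the point in that manifold. -/
theorem exists_smooth_vanishing {j : M → Z} {m : M} {U : Set Z} {r : Z → M}
    (hr : IsLocalRetraction (EM := EM) (EN := E) j m U r)
    (hj : ContMDiff 𝓘(ℝ, EM) 𝓘(ℝ, E) ∞ j) {W : Set Z} (hW : IsOpen W) (hmW : j m ∈ W)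
    (α : Module.Dual ℝ (TangentSpace 𝓘(ℝ, E) (j m)))
    (hα : ∀ v, α (mfderiv 𝓘(ℝ, EM) 𝓘(ℝ, E) j m v) = 0) :
    ∃ f : C^∞⟮𝓘(ℝ, E), Z; ℝ⟯, diffAt f (j m) = α ∧ (∀ y ∉ W, f y = 0) ∧
      ∀ m', r (j m') = m' → f (j m') = 0 := by
  obtain ⟨u, -, hu⟩ := exists_smooth_mfderiv_eq (j m) α
  have h1 : ContMDiffOn 𝓘(ℝ, E) 𝓘(ℝ, ℝ) ∞ (fun y => u (j (r y))) U :=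
    u.contMDiff.comp_contMDiffOn (hj.comp_contMDiffOn hr.contMDiffOn)
  -- The germ is `u - u ∘ j ∘ r`. It vanishes wherever `r` inverts `j`, and its differential at `j
  -- m` is `α` because the subtracted term contributes `α ∘ dj ∘ dr = 0`.
  obtain ⟨f, hf, hfW, h0⟩ := exists_smooth_germ (hW.inter hr.isOpen) (z := j m) ⟨hmW, hr.mem⟩
    (u := fun y => u y - u (j (r y)))
    ((u.contMDiff.contMDiffOn.sub h1).mono Set.inter_subset_right)
  refine ⟨f, ?_, fun y hy => hfW y fun h => hy h.1, fun m' hm' => h0 _ ?_⟩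
  · have hrm : r (j m) = m := hr.eventually.self_of_nhds
    have hrd : MDifferentiableAt 𝓘(ℝ, E) 𝓘(ℝ, EM) r (j m) :=
      ((hr.contMDiffOn _ hr.mem).contMDiffAt (hr.isOpen.mem_nhds hr.mem)).mdifferentiableAt
        (by simp)
    have hjd : MDifferentiableAt 𝓘(ℝ, EM) 𝓘(ℝ, E) j (r (j m)) :=
      hj.mdifferentiable (by simp) _
    have hud : ∀ y, MDifferentiableAt 𝓘(ℝ, E) 𝓘(ℝ, ℝ) u y :=
      fun y => u.contMDiff.mdifferentiable (by simp) y
    have hd := (hud (j m)).hasMFDerivAt.sub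
      (((hud (j (r (j m)))).hasMFDerivAt.comp (j m) (hjd.hasMFDerivAt.comp (j m) hrd.hasMFDerivAt)))
    have hd2 : HasMFDerivAt 𝓘(ℝ, E) 𝓘(ℝ, ℝ) (fun y => u y - u (j (r y))) (j m) _ := hd
    refine LinearMap.ext fun v => ?_
    rw [diffAt, hf.mfderiv_eq, hd2.mfderiv]
    have h5 : ∀ w, mfderiv 𝓘(ℝ, E) 𝓘(ℝ, ℝ) u (j m) w = α w := fun w => congrArg (fun L => L w) hu
    have h6 : ∀ w, mfderiv 𝓘(ℝ, E) 𝓘(ℝ, ℝ) u (j (r (j m)))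
        (mfderiv 𝓘(ℝ, EM) 𝓘(ℝ, E) j (r (j m)) w) = (0 : ℝ) := by
      rw [hrm]
      intro w
      rw [h5]
      exact hα w
    have h7 := congrArg₂ (fun a b : ℝ => a - b) (h5 v) (h6 (mfderiv 𝓘(ℝ, E) 𝓘(ℝ, EM) r (j m) v))
    exact h7.trans (sub_zero _)
  · rw [hm', sub_self]

end Extensions

end SternbergWeinstein

namespace SternbergWeinstein

/-- The differential of a real function, with values in `ℝ`. -/
noncomputable def realDeriv {E H M : Type*} [NormedAddCommGroup E] [NormedSpace ℝ E] [TopologicalSpace H]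
    (I : ModelWithCorners ℝ E H) [TopologicalSpace M] [ChartedSpace H M] (f : M → ℝ) (x : M) :
    TangentSpace I x →L[ℝ] ℝ :=
  mfderiv I 𝓘(ℝ, ℝ) f x

/-! ### The manifold structure of `TM|_X` and differentials on it -/

section PullbackTangent

variable {EX X EM M EN N : Type*} [NormedAddCommGroup EX] [NormedSpace ℝ EX] [TopologicalSpace X]
  [ChartedSpace EX X] [NormedAddCommGroup EM] [NormedSpace ℝ EM] [TopologicalSpace M]
  [ChartedSpace EM M] [IsManifold 𝓘(ℝ, EM) ∞ M]
  [NormedAddCommGroup EN] [NormedSpace ℝ EN] [TopologicalSpace N]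
  [ChartedSpace EN N] [IsManifold 𝓘(ℝ, EN) ∞ N]
  {p : C^∞⟮𝓘(ℝ, EX), X; 𝓘(ℝ, EM), M⟯}

/-- The point of `TM|_X` over `x` given by a tangent vector. -/
abbrev PullbackTangent.mk (p : C^∞⟮𝓘(ℝ, EX), X; 𝓘(ℝ, EM), M⟯) (x : X)
    (v : TangentSpace 𝓘(ℝ, EM) (p x)) : PullbackTangent p :=
  ⟨x, v⟩

/-- The pulled-back bundle inherits its trivializations from `TM`, so both sides impose the same
condition on the fibre coordinate. -/
theorem contMDiffAt_pullbackTangent_iff {EY HY Y : Type*} [NormedAddCommGroup EY] [NormedSpace ℝ EY]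
    [TopologicalSpace HY] {IY : ModelWithCorners ℝ EY HY} [TopologicalSpace Y] [ChartedSpace HY Y]
    {Ψ : Y → PullbackTangent p} {y : Y} :
    ContMDiffAt IY (𝓘(ℝ, EX).prod 𝓘(ℝ, EM)) ∞ Ψ y ↔
      ContMDiffAt IY 𝓘(ℝ, EX) ∞ (fun y => (Ψ y).proj) y ∧
      ContMDiffAt IY (𝓘(ℝ, EM).prod 𝓘(ℝ, EM)) ∞
        (fun y => (⟨p (Ψ y).proj, (Ψ y).snd⟩ : TangentBundle 𝓘(ℝ, EM) M)) y := by
  rw [contMDiffAt_totalSpace, contMDiffAt_totalSpace]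
  constructor
  · rintro ⟨h1, h2⟩
    exact ⟨h1, p.contMDiff.contMDiffAt.comp y h1, h2⟩
  · rintro ⟨h1, -, h2⟩
    exact ⟨h1, h2⟩

theorem contMDiff_toTangentBundle :
    ContMDiff (𝓘(ℝ, EX).prod 𝓘(ℝ, EM)) (𝓘(ℝ, EM).prod 𝓘(ℝ, EM)) ∞
      (fun e : PullbackTangent p => (⟨p e.proj, e.snd⟩ : TangentBundle 𝓘(ℝ, EM) M)) :=
  fun _ => (contMDiffAt_pullbackTangent_iff.1 contMDiffAt_id).2

theorem contMDiff_pullbackTangent_fiber (x : X) :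
    ContMDiff 𝓘(ℝ, EM) (𝓘(ℝ, EX).prod 𝓘(ℝ, EM)) ∞
      (fun w : EM => PullbackTangent.mk p x w) := by
  intro w
  rw [contMDiffAt_totalSpace]
  refine ⟨contMDiffAt_const, ?_⟩
  let t := trivializationAt EM (p *ᵖ (TangentSpace 𝓘(ℝ, EM) : M → Type _)) x
  have hx : x ∈ t.baseSet := mem_baseSet_trivializationAt _ _ _
  let L : EM →L[ℝ] EM := t.continuousLinearMapAt ℝ x
  have h2 : ∀ w, L w = (t ⟨x, w⟩).2 := fun w =>
    congrFun (t.coe_linearMapAt_of_mem (R := ℝ) hx) w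
  exact L.contMDiff.contMDiffAt.congr_of_eventuallyEq (.of_eq (funext fun w => (h2 w).symm))

theorem contMDiff_pullbackTangent_smul (r : ℝ) :
    ContMDiff (𝓘(ℝ, EX).prod 𝓘(ℝ, EM)) (𝓘(ℝ, EX).prod 𝓘(ℝ, EM)) ∞
      (fun e : PullbackTangent p => PullbackTangent.mk p e.proj (r • e.snd)) := by
  intro e
  rw [contMDiffAt_totalSpace]
  refine ⟨contMDiffAt_proj _, ?_⟩
  let t := trivializationAt EM (p *ᵖ (TangentSpace 𝓘(ℝ, EM) : M → Type _)) e.proj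
  have h1 : ContMDiffAt (𝓘(ℝ, EX).prod 𝓘(ℝ, EM)) 𝓘(ℝ, EM) ∞ (fun e' => (t e').2) e :=
    (contMDiffAt_totalSpace.1 contMDiffAt_id).2
  have h3 : ContMDiffAt (𝓘(ℝ, EX).prod 𝓘(ℝ, EM)) 𝓘(ℝ, EM) ∞ (fun e' => r • (t e').2) e :=
    ((r • ContinuousLinearMap.id ℝ EM).contMDiff.contMDiffAt).comp e h1
  refine h3.congr_of_eventuallyEq ?_
  have h2 : ∀ᶠ e' : PullbackTangent p in 𝓝 e, e'.proj ∈ t.baseSet :=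
    (FiberBundle.continuous_proj EM _).continuousAt.eventually
      (t.open_baseSet.mem_nhds (mem_baseSet_trivializationAt _ _ _))
  filter_upwards [h2] with e' he'
  exact (t.linear ℝ he').map_smul r e'.snd

theorem contMDiff_diffAt (f : C^∞⟮𝓘(ℝ, EM), M; ℝ⟯) :
    ContMDiff (𝓘(ℝ, EX).prod 𝓘(ℝ, EM)) 𝓘(ℝ, ℝ) ∞
      (fun e : PullbackTangent p => diffAt f (p e.proj) e.snd) :=
  (contMDiff_snd_tangentBundle_modelSpace ℝ 𝓘(ℝ, ℝ)).comp
    ((f.contMDiff.contMDiff_tangentMap (m := ∞) (by simp)).comp contMDiff_toTangentBundle)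

omit [IsManifold 𝓘(ℝ, EM) ∞ M] in
theorem tangentBundle_mk_eq {m m' : M} (h : m = m') (v : EM) :
    (⟨m, v⟩ : TangentBundle 𝓘(ℝ, EM) M) = ⟨m', v⟩ := by
  subst h
  rfl

/-- The map `TN|_X → TM|_X` induced by `r : N → M` over a set where `r ∘ p = q`. -/
theorem contMDiffOn_pullbackTangent_map {q : C^∞⟮𝓘(ℝ, EX), X; 𝓘(ℝ, EN), N⟯} {r : N → M} {U : Set N}
    (hU : IsOpen U) (hr : ContMDiffOn 𝓘(ℝ, EN) 𝓘(ℝ, EM) ∞ r U) {V : Set X} (hV : IsOpen V)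
    (h : ∀ x ∈ V, q x ∈ U ∧ r (q x) = p x) :
    ContMDiffOn (𝓘(ℝ, EX).prod 𝓘(ℝ, EN)) (𝓘(ℝ, EX).prod 𝓘(ℝ, EM)) ∞
      (fun e : PullbackTangent q => PullbackTangent.mk p e.proj
        (mfderiv 𝓘(ℝ, EN) 𝓘(ℝ, EM) r (q e.proj) e.snd : EM)) {e | e.proj ∈ V} := by
  intro e he
  refine ContMDiffAt.contMDiffWithinAt ?_
  rw [contMDiffAt_pullbackTangent_iff]
  refine ⟨contMDiffAt_proj _, ?_⟩
  have h1 := hr.contMDiffOn_tangentMapWithin (m := ∞) (by simp) hU.uniqueMDiffOn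
  have h2 := (h1 ⟨q e.proj, e.snd⟩ (h _ he).1).contMDiffAt
    ((hU.preimage (FiberBundle.continuous_proj EN _)).mem_nhds (h _ he).1)
  refine (h2.comp e (contMDiff_toTangentBundle e)).congr_of_eventuallyEq ?_
  have h3 : ∀ᶠ e' : PullbackTangent q in 𝓝 e, e'.proj ∈ V :=
    (FiberBundle.continuous_proj EN _).continuousAt.eventually (hV.mem_nhds he)
  filter_upwards [h3] with e' he'
  have h4 : mfderivWithin 𝓘(ℝ, EN) 𝓘(ℝ, EM) r U (q e'.proj) =
      mfderiv 𝓘(ℝ, EN) 𝓘(ℝ, EM) r (q e'.proj) := mfderivWithin_of_isOpen hU (h _ he').1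
  change _ = (⟨r (q e'.proj), mfderivWithin 𝓘(ℝ, EN) 𝓘(ℝ, EM) r U (q e'.proj) e'.snd⟩ :
    TangentBundle 𝓘(ℝ, EM) M)
  rw [h4]
  exact tangentBundle_mk_eq (h _ he').2.symm _

/-- The local section of `TM|_X` through `e` which is constant in the standard trivialization. -/
noncomputable def constSection (e : PullbackTangent p) (x : X) : PullbackTangent p :=
  (trivializationAt EM (p *ᵖ (TangentSpace 𝓘(ℝ, EM) : M → Type _)) e.proj).toOpenPartialHomeomorph.symm
    (x, (trivializationAt EM (p *ᵖ (TangentSpace 𝓘(ℝ, EM) : M → Type _)) e.proj e).2)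

/-- The decomposition of the differential at a point of `TM|_X` given by a trivialization. -/
theorem exists_mfderiv_decomposition [IsManifold 𝓘(ℝ, EX) ∞ X] (e : PullbackTangent p) :
    ∃ (a : TangentSpace (𝓘(ℝ, EX).prod 𝓘(ℝ, EM)) e → TangentSpace 𝓘(ℝ, EX) e.proj)
      (b : TangentSpace (𝓘(ℝ, EX).prod 𝓘(ℝ, EM)) e → EM),
      ∀ A : PullbackTangent p → ℝ, MDifferentiableAt (𝓘(ℝ, EX).prod 𝓘(ℝ, EM)) 𝓘(ℝ, ℝ) A e →
        MDifferentiableAt 𝓘(ℝ, EX) 𝓘(ℝ, ℝ) (fun x => A (constSection e x)) e.proj ∧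
        ∀ ζ, realDeriv (𝓘(ℝ, EX).prod 𝓘(ℝ, EM)) A e ζ =
          realDeriv 𝓘(ℝ, EX) (fun x => A (constSection e x)) e.proj (a ζ) +
          fderiv ℝ (fun w : EM => A (PullbackTangent.mk p e.proj w)) e.snd (b ζ) := by
  let t := trivializationAt EM (p *ᵖ (TangentSpace 𝓘(ℝ, EM) : M → Type _)) e.proj
  have hx : e.proj ∈ t.baseSet := mem_baseSet_trivializationAt _ _ _
  have he : e ∈ t.source := t.mem_source.2 hx
  have ht1 : t e = (e.proj, (t e).2) := Prod.ext (t.coe_fst he) rfl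
  have ht : MDifferentiableAt (𝓘(ℝ, EX).prod 𝓘(ℝ, EM)) (𝓘(ℝ, EX).prod 𝓘(ℝ, EM)) t e :=
    ((t.contMDiffOn (IB := 𝓘(ℝ, EX)) (n := ∞) e he).contMDiffAt
      (t.open_source.mem_nhds he)).mdifferentiableAt (by simp)
  have hts : MDifferentiableAt (𝓘(ℝ, EX).prod 𝓘(ℝ, EM)) (𝓘(ℝ, EX).prod 𝓘(ℝ, EM))
      t.toOpenPartialHomeomorph.symm (t e) :=
    ((t.contMDiffOn_symm (IB := 𝓘(ℝ, EX)) (n := ∞) (t e) (t.map_source he)).contMDiffAt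
      (t.open_target.mem_nhds (t.map_source he))).mdifferentiableAt (by simp)
  have hse : t.toOpenPartialHomeomorph.symm (t e) = e := t.toOpenPartialHomeomorph.left_inv he
  let L : EM →L[ℝ] EM := t.symmL ℝ e.proj
  have hL : ∀ w, L w = t.symm e.proj w := fun w => t.symmL_apply hx w
  let T : TangentSpace (𝓘(ℝ, EX).prod 𝓘(ℝ, EM)) e → EX × EM :=
    fun ζ => mfderiv (𝓘(ℝ, EX).prod 𝓘(ℝ, EM)) (𝓘(ℝ, EX).prod 𝓘(ℝ, EM)) t e ζ
  -- A trivialization splits a tangent vector into a base part and a fibre part; the fibre part is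
  -- carried back to the actual fibre by the linear map `L`.
  refine ⟨fun ζ => (T ζ).1, fun ζ => L (T ζ).2, fun A hA => ?_⟩
  obtain ⟨v₀, hv₀⟩ : ∃ v₀, v₀ = (t e).2 := ⟨_, rfl⟩
  rw [← hv₀] at ht1
  let A' : X × EM → ℝ := fun y => A (t.toOpenPartialHomeomorph.symm y)
  have hA' : MDifferentiableAt (𝓘(ℝ, EX).prod 𝓘(ℝ, EM)) 𝓘(ℝ, ℝ) A' (t e) :=
    MDifferentiableAt.comp (t e) (by rw [hse]; exact hA) hts
  have hA'' : MDifferentiableAt (𝓘(ℝ, EX).prod 𝓘(ℝ, EM)) 𝓘(ℝ, ℝ) A' (e.proj, v₀) := ht1 ▸ hA'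
  have hsec' : (fun x => A (constSection e x)) = fun x => A' (x, v₀) := by
    rw [hv₀]; rfl
  have hsec : MDifferentiableAt 𝓘(ℝ, EX) 𝓘(ℝ, ℝ) (fun x => A' (x, v₀)) e.proj :=
    MDifferentiableAt.comp (I' := 𝓘(ℝ, EX).prod 𝓘(ℝ, EM)) (f := fun x => (x, v₀)) e.proj hA''
      (mdifferentiableAt_id.prodMk mdifferentiableAt_const)
  rw [hsec']
  refine ⟨hsec, fun ζ => ?_⟩
  have hAe : A =ᶠ[𝓝 e] A' ∘ t := by
    filter_upwards [t.open_source.mem_nhds he] with e' he'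
    exact (congrArg A (t.toOpenPartialHomeomorph.left_inv he')).symm
  have hfib : (fun w => A' (e.proj, w)) =
      (fun w : EM => A (PullbackTangent.mk p e.proj w)) ∘ L := by
    funext w
    rw [Function.comp_apply, hL]
    exact congrArg A (t.mk_symm hx w).symm
  have hLe : L v₀ = e.snd := by
    rw [hL, hv₀]
    exact t.symm_apply_apply_mk hx e.snd
  have hfd : DifferentiableAt ℝ (fun w : EM => A (PullbackTangent.mk p e.proj w)) (L v₀) := by
    rw [hLe]
    have h := MDifferentiableAt.comp (I' := 𝓘(ℝ, EX).prod 𝓘(ℝ, EM))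
      (f := fun w : EM => PullbackTangent.mk p e.proj w) (e.snd : EM) hA
      ((contMDiff_pullbackTangent_fiber e.proj).mdifferentiable (by simp) _)
    exact h.differentiableAt
  have h1 : ∀ y, y = t e → realDeriv (𝓘(ℝ, EX).prod 𝓘(ℝ, EM)) A e ζ =
      realDeriv (𝓘(ℝ, EX).prod 𝓘(ℝ, EM)) A' y (T ζ) := by
    rintro _ rfl
    rw [realDeriv, hAe.mfderiv_eq, mfderiv_comp e hA' ht]
    rfl
  rw [h1 _ ht1.symm]
  refine (mfderiv_prod_eq_add_apply (v := T ζ) hA'').trans ?_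
  have h3 : fderiv ℝ (fun w => A' (e.proj, w)) v₀ (T ζ).2 =
      fderiv ℝ (fun w : EM => A (PullbackTangent.mk p e.proj w)) e.snd (L (T ζ).2) := by
    rw [hfib, fderiv_comp _ hfd L.differentiableAt, L.fderiv, hLe]
    rfl
  rw [← h3, ← mfderiv_eq_fderiv]
  rfl

/-- A differential at a point of `TM|_X` is determined by its restrictions to the fibre and to a
section. -/
theorem mfderiv_eq_of_fiber_of_section [IsManifold 𝓘(ℝ, EX) ∞ X] {A B : PullbackTangent p → ℝ}
    {e : PullbackTangent p}
    (hA : MDifferentiableAt (𝓘(ℝ, EX).prod 𝓘(ℝ, EM)) 𝓘(ℝ, ℝ) A e)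
    (hB : MDifferentiableAt (𝓘(ℝ, EX).prod 𝓘(ℝ, EM)) 𝓘(ℝ, ℝ) B e)
    (hv : fderiv ℝ (fun w : EM => A (PullbackTangent.mk p e.proj w)) e.snd =
      fderiv ℝ (fun w : EM => B (PullbackTangent.mk p e.proj w)) e.snd)
    (hs : realDeriv 𝓘(ℝ, EX) (fun x => A (constSection e x)) e.proj =
      realDeriv 𝓘(ℝ, EX) (fun x => B (constSection e x)) e.proj) :
    realDeriv (𝓘(ℝ, EX).prod 𝓘(ℝ, EM)) A e = realDeriv (𝓘(ℝ, EX).prod 𝓘(ℝ, EM)) B e := by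
  obtain ⟨a, b, h⟩ := exists_mfderiv_decomposition e
  ext ζ
  rw [(h A hA).2, (h B hB).2, hv, hs]

end PullbackTangent

end SternbergWeinstein

namespace SternbergWeinstein

theorem NormalBundle.proj_mk_eq_iff {EX X EM M : Type*} [NormedAddCommGroup EX] [NormedSpace ℝ EX]
    [TopologicalSpace X] [ChartedSpace EX X] [NormedAddCommGroup EM] [NormedSpace ℝ EM]
    [TopologicalSpace M] [ChartedSpace EM M] {p : C^∞⟮𝓘(ℝ, EX), X; 𝓘(ℝ, EM), M⟯}
    {W : ∀ x, Submodule ℝ (TangentSpace 𝓘(ℝ, EM) (p x))} {x : X}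
    {v w : TangentSpace 𝓘(ℝ, EM) (p x)} :
    (NormalBundle.proj (PullbackTangent.mk p x v) : NormalBundle p W) =
      NormalBundle.proj (PullbackTangent.mk p x w) ↔ v - w ∈ W x := by
  rw [← Submodule.Quotient.eq]
  exact ⟨fun h => eq_of_heq (Sigma.mk.inj h).2, fun h => Sigma.ext rfl (heq_of_eq h)⟩

/-! ### The inclusion of `Q'` and extension of functions from it -/

namespace Inclusions

variable {EX X ES S EQ Q E Z : Type*}
  [NormedAddCommGroup EX] [NormedSpace ℝ EX] [TopologicalSpace X] [ChartedSpace EX X]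
  [NormedAddCommGroup ES] [NormedSpace ℝ ES] [TopologicalSpace S] [ChartedSpace ES S]
  [NormedAddCommGroup EQ] [NormedSpace ℝ EQ] [TopologicalSpace Q] [ChartedSpace EQ Q]
  [NormedAddCommGroup E] [NormedSpace ℝ E] [TopologicalSpace Z] [ChartedSpace E Z]
  {J : Inclusions EX X ES S EQ Q E Z}

theorem mfderiv_toZ (x : X) (v : TangentSpace 𝓘(ℝ, EX) x) :
    (mfderiv 𝓘(ℝ, EX) 𝓘(ℝ, E) J.toZ x v : E) =
      J.tangentQ x (mfderiv 𝓘(ℝ, EX) 𝓘(ℝ, EQ) J.toQ x v) := by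
  have h : mfderiv 𝓘(ℝ, EX) 𝓘(ℝ, E) J.toZ x =
      (mfderiv 𝓘(ℝ, EQ) 𝓘(ℝ, E) J.iQ (J.toQ x)).comp (mfderiv 𝓘(ℝ, EX) 𝓘(ℝ, EQ) J.toQ x) :=
    mfderiv_comp x (J.iQ.contMDiff.mdifferentiable (by simp) _)
      (J.toQ.contMDiff.mdifferentiable (by simp) _)
  rw [h]
  rfl

theorem mfderiv_toZ_mem_TX (x : X) (v : TangentSpace 𝓘(ℝ, EX) x) :
    (mfderiv 𝓘(ℝ, EX) 𝓘(ℝ, E) J.toZ x v : E) ∈ J.TX x :=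
  ⟨_, ⟨v, rfl⟩, (mfderiv_toZ x v).symm⟩

theorem inclQ'_proj (x : X) (v : TangentSpace 𝓘(ℝ, EQ) (J.toQ x)) :
    J.inclQ' (NormalBundle.proj (PullbackTangent.mk J.toQ x v)) =
      NormalBundle.proj (PullbackTangent.mk J.toZ x (J.tangentQ x v)) :=
  rfl

/-- Lifts to `TZ|_X` of a point of `Q'` are automatically tangent to `Q`, because `TX` lies in `TQ`.
This controls the arbitrary lift chosen in `swBracket`. -/
theorem proj_eq_inclQ'_iff {e : PullbackTangent J.toZ} {x : X}
    {v : TangentSpace 𝓘(ℝ, EQ) (J.toQ x)} :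
    NormalBundle.proj e = J.inclQ' (NormalBundle.proj (PullbackTangent.mk J.toQ x v)) ↔
      ∃ u ∈ J.TXinQ x, e = PullbackTangent.mk J.toZ x (J.tangentQ x (v + u)) := by
  constructor
  · intro h
    obtain ⟨y, w⟩ := e
    rw [inclQ'_proj] at h
    obtain rfl : y = x := congrArg Sigma.fst h
    have h1 := NormalBundle.proj_mk_eq_iff (p := J.toZ).1 h
    obtain ⟨u, hu, h2⟩ := h1
    refine ⟨u, hu, ?_⟩
    rw [map_add, h2]
    exact congrArg (PullbackTangent.mk J.toZ y) (add_sub_cancel _ _).symm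
  · rintro ⟨u, hu, rfl⟩
    rw [inclQ'_proj, NormalBundle.proj_mk_eq_iff, map_add, add_sub_cancel_left]
    exact ⟨u, hu, rfl⟩

theorem isSmooth_comp_projL [IsManifold 𝓘(ℝ, EQ) ∞ Q] {h : J.LQuotDual → ℝ}
    (hh : NormalBundle.IsSmooth h) : NormalBundle.IsSmooth (h ∘ J.projL) :=
  hh

section Retraction

variable [IsManifold 𝓘(ℝ, EX) ∞ X] [IsManifold 𝓘(ℝ, ES) ∞ S] [IsManifold 𝓘(ℝ, EQ) ∞ Q]
  [IsManifold 𝓘(ℝ, E) ∞ Z]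

-- Compose the local retractions of `Z` onto the leaf and of the leaf onto `X`. The leaf is only
-- immersed, but a left inverse near a point of the source is all that is needed.
omit [IsManifold 𝓘(ℝ, EQ) ∞ Q] in
theorem exists_retraction_toZ {P : PoissonStructure E Z}
    (hS : P.IsSymplecticLeaf (EM := ES) (fun s => J.iQ (J.iS s)))
    (hX : Manifold.IsSmoothEmbedding 𝓘(ℝ, EX) 𝓘(ℝ, ES) ∞ J.iX) (x : X) :
    ∃ U r, IsLocalRetraction (EM := EX) (EN := E) J.toZ x U r := by
  obtain ⟨U, r, h1⟩ := exists_isLocalRetraction (hX.isImmersion.isImmersionAt x)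
  obtain ⟨V, q, h2⟩ := exists_isLocalRetraction (hS.immersion.isImmersionAt (J.iX x))
  exact ⟨_, _, h2.comp h1 J.iX.contMDiff.continuous.continuousAt⟩

omit [IsManifold 𝓘(ℝ, EX) ∞ X] [IsManifold 𝓘(ℝ, ES) ∞ S] in
theorem exists_retraction_iQ (hQ : Manifold.IsSmoothEmbedding 𝓘(ℝ, EQ) 𝓘(ℝ, E) ∞ J.iQ) (q : Q) :
    ∃ U r, IsLocalRetraction (EM := EQ) (EN := E) J.iQ q U r :=
  exists_isLocalRetraction (hQ.isImmersion.isImmersionAt q)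

omit [IsManifold 𝓘(ℝ, EX) ∞ X] [IsManifold 𝓘(ℝ, ES) ∞ S] in
theorem tangentQ_injective (hQ : Manifold.IsSmoothEmbedding 𝓘(ℝ, EQ) 𝓘(ℝ, E) ∞ J.iQ) (x : X) :
    Function.Injective (J.tangentQ x) := by
  obtain ⟨U, r, h⟩ := exists_retraction_iQ hQ (J.toQ x)
  intro v w hvw
  have h1 := h.mfderiv_apply (J.iQ.contMDiff.mdifferentiable (by simp) _)
  have h2 : mfderiv 𝓘(ℝ, EQ) 𝓘(ℝ, E) J.iQ (J.toQ x) v =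
    mfderiv 𝓘(ℝ, EQ) 𝓘(ℝ, E) J.iQ (J.toQ x) w := hvw
  exact (h1 v).symm.trans ((congrArg _ h2).trans (h1 w))

omit [IsManifold 𝓘(ℝ, ES) ∞ S] in
/-- Smooth functions on `TQ|_X / TX` extend to `TZ|_X / TX`. -/
theorem exists_smooth_extension [FiniteDimensional ℝ EX] [T2Space X] [SigmaCompactSpace X]
    (hQ : Manifold.IsSmoothEmbedding 𝓘(ℝ, EQ) 𝓘(ℝ, E) ∞ J.iQ) {φ : J.EQuotDual → ℝ}
    (hφ : NormalBundle.IsSmooth φ) :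
    ∃ F : J.EDual → ℝ, NormalBundle.IsSmooth F ∧ F ∘ J.inclQ' = φ := by
  have hloc : ∀ x : X, ∃ (V : Set X) (U : Set Z) (r : Z → Q), IsOpen V ∧ x ∈ V ∧
      ∀ y ∈ V, IsLocalRetraction (EM := EQ) (EN := E) J.iQ (J.toQ y) U r := by
    intro x
    obtain ⟨U, r, h⟩ := exists_retraction_iQ hQ (J.toQ x)
    have h1 := h.eventually_isLocalRetraction J.iQ.contMDiff.continuous.continuousAt
    obtain ⟨V, hV, hVo, hxV⟩ := eventually_nhds_iff.1
      (J.toQ.contMDiff.continuous.continuousAt.eventually h1)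
    exact ⟨V, U, r, hVo, hxV, hV⟩
  choose V U r hVo hxV hr using hloc
  obtain ⟨ρ, hρ⟩ := SmoothPartitionOfUnity.exists_isSubordinate 𝓘(ℝ, EX) isClosed_univ V hVo
    (fun x _ => Set.mem_iUnion.2 ⟨x, hxV x⟩)
  -- the local extensions
  let Φ : X → PullbackTangent J.toZ → ℝ := fun i e =>
    φ (NormalBundle.proj (PullbackTangent.mk J.toQ e.proj
      (mfderiv 𝓘(ℝ, E) 𝓘(ℝ, EQ) (r i) (J.toZ e.proj) e.snd : EQ)))
  have hret : ∀ i, ∀ y ∈ V i, ∀ v : TangentSpace 𝓘(ℝ, EQ) (J.toQ y),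
      (mfderiv 𝓘(ℝ, E) 𝓘(ℝ, EQ) (r i) (J.toZ y) (J.tangentQ y v) : EQ) = v := fun i y hy v =>
    (hr i y hy).mfderiv_apply (J.iQ.contMDiff.mdifferentiable (by simp) _) v
  have hΦs : ∀ i, ContMDiffOn (𝓘(ℝ, EX).prod 𝓘(ℝ, E)) 𝓘(ℝ, ℝ) ∞ (Φ i) {e | e.proj ∈ V i} := by
    intro i e he
    have h1 := contMDiffOn_pullbackTangent_map (p := J.toQ) (q := J.toZ) (hr i _ he).isOpen
      (hr i _ he).contMDiffOn (hVo i)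
      (fun y hy => ⟨(hr i y hy).mem, (hr i y hy).eventually.self_of_nhds⟩)
    exact ContMDiff.comp_contMDiffOn hφ h1 e he
  -- The differential of the retraction inverts `tangentQ`, so it maps `TX` into `TX ⊆ TQ` and the
  -- local extension descends to the quotient.
  have hΦ : ∀ i, ∀ y ∈ V i, ∀ w w' : TangentSpace 𝓘(ℝ, E) (J.toZ y),
      (J.TX y).mkQ w = (J.TX y).mkQ w' →
      Φ i (PullbackTangent.mk J.toZ y w) = Φ i (PullbackTangent.mk J.toZ y w') := by
    intro i y hy w w' hw
    rw [Submodule.mkQ_apply, Submodule.mkQ_apply, Submodule.Quotient.eq] at hw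
    obtain ⟨u, hu, h2⟩ := hw
    have h3 := hret i y hy u
    rw [h2] at h3
    have h4 := (map_sub (mfderiv 𝓘(ℝ, E) 𝓘(ℝ, EQ) (r i) (J.toZ y)) w w').symm.trans h3
    exact congrArg φ (NormalBundle.proj_mk_eq_iff.2 ((congrArg (· ∈ J.TXinQ y) h4).mpr hu))
  -- The representative is arbitrary; it does not matter where `ρ i ≠ 0`. The weights depend only on
  -- the base point and sum to one, so the gluing does not alter values on `Q'`.
  let F : J.EDual → ℝ := fun ξ => ∑ᶠ i, ρ i ξ.1 * Φ i (PullbackTangent.mk J.toZ ξ.1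
    (Function.surjInv (J.TX ξ.1).mkQ_surjective ξ.2))
  have hF : ∀ e : PullbackTangent J.toZ, F (NormalBundle.proj e) = ∑ᶠ i, ρ i e.proj * Φ i e := by
    intro e
    refine finsum_congr fun i => ?_
    by_cases h0 : ρ i e.proj = 0
    · change ρ i e.proj * _ = _
      rw [h0, zero_mul, zero_mul]
    · have hy : e.proj ∈ V i := hρ i (subset_closure h0)
      change ρ i e.proj * _ = ρ i e.proj * _
      congr 1
      exact hΦ i e.proj hy _ e.snd (Function.surjInv_eq _ _)
  refine ⟨F, ?_, ?_⟩
  · have h1 : (fun e : PullbackTangent J.toZ => F (NormalBundle.proj e)) =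
        fun e => ∑ᶠ i, ρ i e.proj * Φ i e := funext hF
    rw [NormalBundle.IsSmooth, h1]
    have hpc : Continuous (fun e : PullbackTangent J.toZ => e.proj) :=
      FiberBundle.continuous_proj E _
    refine contMDiff_finsum (fun i => ?_) ?_
    · refine contMDiff_of_tsupport fun e he => ?_
      have he' : e.proj ∈ V i := by
        refine hρ i ?_
        have h2 : closure (Function.support fun e : PullbackTangent J.toZ => ρ i e.proj * Φ i e) ⊆
            (fun e : PullbackTangent J.toZ => e.proj) ⁻¹' tsupport (ρ i) :=
          closure_minimal (fun e he => subset_closure (left_ne_zero_of_mul he))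
            ((isClosed_tsupport _).preimage hpc)
        exact h2 he
      exact ((ρ i).contMDiff.contMDiffAt.comp e (contMDiffAt_proj _)).mul
        ((hΦs i e he').contMDiffAt (((hVo i).preimage hpc).mem_nhds he'))
    · exact (ρ.locallyFinite.preimage_continuous hpc).subset
        fun i e he => left_ne_zero_of_mul he
  · funext η
    obtain ⟨x, v⟩ := η
    obtain ⟨v, rfl⟩ := (J.TXinQ x).mkQ_surjective v
    have h1 := hF (PullbackTangent.mk J.toZ x (J.tangentQ x v))
    refine h1.trans ?_
    have h2 : ∀ i, ρ i x * Φ i (PullbackTangent.mk J.toZ x (J.tangentQ x v)) =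
        ρ i x * φ ⟨x, (J.TXinQ x).mkQ v⟩ := by
      intro i
      by_cases h0 : ρ i x = 0
      · rw [h0, zero_mul, zero_mul]
      · have hy : x ∈ V i := hρ i (subset_closure h0)
        congr 1
        refine congrArg φ (Sigma.ext rfl (heq_of_eq ?_))
        exact congrArg (J.TXinQ x).mkQ (hret i x hy v)
    rw [finsum_congr h2, ← finsum_mul, ρ.sum_eq_one (Set.mem_univ x), one_mul]

end Retraction

end Inclusions
end SternbergWeinstein

namespace SternbergWeinstein

section PullbackTangent

variable {EX X EM M : Type*} [NormedAddCommGroup EX] [NormedSpace ℝ EX] [TopologicalSpace X]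
  [ChartedSpace EX X] [NormedAddCommGroup EM] [NormedSpace ℝ EM] [TopologicalSpace M]
  [ChartedSpace EM M] [IsManifold 𝓘(ℝ, EM) ∞ M]
  {p : C^∞⟮𝓘(ℝ, EX), X; 𝓘(ℝ, EM), M⟯}

theorem realDeriv_add {f h : X → ℝ} {x : X} (hf : MDifferentiableAt 𝓘(ℝ, EX) 𝓘(ℝ, ℝ) f x)
    (hh : MDifferentiableAt 𝓘(ℝ, EX) 𝓘(ℝ, ℝ) h x) :
    realDeriv 𝓘(ℝ, EX) (fun y => f y + h y) x =
      realDeriv 𝓘(ℝ, EX) f x + realDeriv 𝓘(ℝ, EX) h x :=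
  (hf.hasMFDerivAt.add hh.hasMFDerivAt).mfderiv

theorem realDeriv_sub {f h : X → ℝ} {x : X} (hf : MDifferentiableAt 𝓘(ℝ, EX) 𝓘(ℝ, ℝ) f x)
    (hh : MDifferentiableAt 𝓘(ℝ, EX) 𝓘(ℝ, ℝ) h x) :
    realDeriv 𝓘(ℝ, EX) (fun y => f y - h y) x =
      realDeriv 𝓘(ℝ, EX) f x - realDeriv 𝓘(ℝ, EX) h x :=
  (hf.hasMFDerivAt.sub hh.hasMFDerivAt).mfderiv

theorem differentiableAt_fiber {A : PullbackTangent p → ℝ} {e : PullbackTangent p}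
    (hA : MDifferentiableAt (𝓘(ℝ, EX).prod 𝓘(ℝ, EM)) 𝓘(ℝ, ℝ) A e) :
    DifferentiableAt ℝ (fun w : EM => A (PullbackTangent.mk p e.proj w)) e.snd :=
  (MDifferentiableAt.comp (I' := 𝓘(ℝ, EX).prod 𝓘(ℝ, EM))
    (f := fun w : EM => PullbackTangent.mk p e.proj w) (e.snd : EM) hA
    ((contMDiff_pullbackTangent_fiber e.proj).mdifferentiable (by simp) _)).differentiableAt

theorem fderiv_fiber_eq {A : PullbackTangent p → ℝ} {e : PullbackTangent p}
    (hA : MDifferentiableAt (𝓘(ℝ, EX).prod 𝓘(ℝ, EM)) 𝓘(ℝ, ℝ) A e) (v : EM) :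
    fderiv ℝ (fun w : EM => A (PullbackTangent.mk p e.proj w)) e.snd v =
      realDeriv (𝓘(ℝ, EX).prod 𝓘(ℝ, EM)) A e (mfderiv 𝓘(ℝ, EM) (𝓘(ℝ, EX).prod 𝓘(ℝ, EM))
        (fun w : EM => PullbackTangent.mk p e.proj w) (e.snd : EM) v) := by
  have h := mfderiv_comp (I' := 𝓘(ℝ, EX).prod 𝓘(ℝ, EM))
    (f := fun w : EM => PullbackTangent.mk p e.proj w) (e.snd : EM) hA
    ((contMDiff_pullbackTangent_fiber e.proj).mdifferentiable (by simp) _)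
  have h2 : mfderiv 𝓘(ℝ, EM) 𝓘(ℝ, ℝ) (fun w : EM => A (PullbackTangent.mk p e.proj w)) e.snd =
    fderiv ℝ (fun w : EM => A (PullbackTangent.mk p e.proj w)) e.snd := mfderiv_eq_fderiv
  exact congrArg (fun L : EM →L[ℝ] ℝ => L v) (h2.symm.trans h)

theorem fderiv_fiber_linear (α : EM →L[ℝ] ℝ) (r : ℝ) (w : EM) :
    fderiv ℝ (fun w => α w + r) w = α :=
  (α.hasFDerivAt.add_const r).fderiv

theorem eventually_constSection_proj (e : PullbackTangent p) :
    ∀ᶠ x in 𝓝 e.proj, (constSection e x).proj = x := by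
  let t := trivializationAt EM (p *ᵖ (TangentSpace 𝓘(ℝ, EM) : M → Type _)) e.proj
  filter_upwards [t.open_baseSet.mem_nhds (mem_baseSet_trivializationAt _ _ e.proj)] with x hx
  exact t.proj_symm_apply' hx

end PullbackTangent

/-! ### First jets of functions on `E_X^*` -/

namespace Inclusions

variable {EX X ES S EQ Q E Z : Type*}
  [NormedAddCommGroup EX] [NormedSpace ℝ EX] [TopologicalSpace X] [ChartedSpace EX X]
  [NormedAddCommGroup ES] [NormedSpace ℝ ES] [TopologicalSpace S] [ChartedSpace ES S]
  [NormedAddCommGroup EQ] [NormedSpace ℝ EQ] [TopologicalSpace Q] [ChartedSpace EQ Q]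
  [NormedAddCommGroup E] [NormedSpace ℝ E] [TopologicalSpace Z] [ChartedSpace E Z]
  {J : Inclusions EX X ES S EQ Q E Z} [IsManifold 𝓘(ℝ, E) ∞ Z]

theorem mdifferentiableAt_jet (f k : C^∞⟮𝓘(ℝ, E), Z; ℝ⟯) (e : PullbackTangent J.toZ) :
    MDifferentiableAt (𝓘(ℝ, EX).prod 𝓘(ℝ, E)) 𝓘(ℝ, ℝ)
      (fun e' : PullbackTangent J.toZ =>
        diffAt f (J.toZ e'.proj) e'.snd + k (J.toZ e'.proj)) e :=
  ((contMDiff_diffAt f).mdifferentiable (by simp) e).add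
    (((k.contMDiff.comp J.toZ.contMDiff).comp (contMDiff_proj _)).mdifferentiable (by simp) e)

/-- The comparison function is affine on each fibre with linear part `df`. So `df` at the base point
is the vertical derivative of `F`, whichever jet is chosen. -/
theorem IsFirstJet.diffAt_eq {F : J.EDual → ℝ} (hF : NormalBundle.IsSmooth F)
    {e : PullbackTangent J.toZ} {f k : C^∞⟮𝓘(ℝ, E), Z; ℝ⟯} (h : J.IsFirstJet F e f k)
    (v : TangentSpace 𝓘(ℝ, E) (J.toZ e.proj)) :
    diffAt f (J.toZ e.proj) v =
      fderiv ℝ (fun w : E => F (NormalBundle.proj (PullbackTangent.mk J.toZ e.proj w))) e.snd v := by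
  have h1 := fderiv_fiber_eq (ContMDiff.mdifferentiable hF (by simp) e) v
  have h2 := fderiv_fiber_eq (mdifferentiableAt_jet (J := J) f k e) v
  let D : E →L[ℝ] ℝ := mfderiv 𝓘(ℝ, E) 𝓘(ℝ, ℝ) f (J.toZ e.proj)
  have h3 := fderiv_fiber_linear D (k (J.toZ e.proj)) e.snd
  refine Eq.trans ?_ h1.symm
  rw [show realDeriv (𝓘(ℝ, EX).prod 𝓘(ℝ, E)) _ e = _ from h.2]
  refine Eq.trans ?_ h2
  exact (congrArg (fun L => L v) h3).symm

/-- The vertical derivative of `F` kills `TX`, hence equals `df` at the base point for some `f`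
vanishing on `X` nearby. The remaining discrepancy is horizontal and is absorbed by `k`. -/
theorem exists_isFirstJet [FiniteDimensional ℝ EX] [T2Space X] [IsManifold 𝓘(ℝ, EX) ∞ X]
    [FiniteDimensional ℝ E] [T2Space Z] {F : J.EDual → ℝ} (hF : NormalBundle.IsSmooth F)
    {e : PullbackTangent J.toZ} {U : Set Z} {r : Z → X}
    (hr : IsLocalRetraction (EM := EX) (EN := E) J.toZ e.proj U r) :
    ∃ f k, J.IsFirstJet F e f k := by
  have hFd : ∀ e, MDifferentiableAt (𝓘(ℝ, EX).prod 𝓘(ℝ, E)) 𝓘(ℝ, ℝ)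
      (fun e' : PullbackTangent J.toZ => F (NormalBundle.proj e')) e :=
    ContMDiff.mdifferentiable hF (by simp)
  let α : E →L[ℝ] ℝ :=
    fderiv ℝ (fun w : E => F (NormalBundle.proj (PullbackTangent.mk J.toZ e.proj w))) e.snd
  -- `F` is defined on the quotient by `TX`, hence constant along lines in these directions.
  have hα : ∀ v, α (mfderiv 𝓘(ℝ, EX) 𝓘(ℝ, E) J.toZ e.proj v) = 0 := by
    intro v
    let v' : E := mfderiv 𝓘(ℝ, EX) 𝓘(ℝ, E) J.toZ e.proj v
    let w₀ : E := e.snd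
    have h1 := (differentiableAt_fiber (hFd e)).lineDeriv_eq_fderiv (v := v')
    refine h1.symm.trans ?_
    have h2 : ∀ t : ℝ, F (NormalBundle.proj (PullbackTangent.mk J.toZ e.proj (w₀ + t • v'))) =
        F (NormalBundle.proj e) := by
      intro t
      refine congrArg F (NormalBundle.proj_mk_eq_iff (p := J.toZ) (w := e.snd).2 ?_)
      have h3 := (J.TX e.proj).smul_mem t (mfderiv_toZ_mem_TX (J := J) e.proj v)
      exact (congrArg (· ∈ J.TX e.proj) (add_sub_cancel_left w₀ (t • v'))).mpr h3
    have h4 : (fun t : ℝ => F (NormalBundle.proj (PullbackTangent.mk J.toZ e.proj (w₀ + t • v')))) =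
        fun _ => F (NormalBundle.proj e) := funext h2
    exact (congrArg (fun u => deriv u 0) h4).trans (deriv_const _ _)
  obtain ⟨f, hf, -, hf0⟩ := exists_smooth_vanishing hr J.toZ.contMDiff isOpen_univ trivial
    (α : E →ₗ[ℝ] ℝ) hα
  let A : X → ℝ := fun x => F (NormalBundle.proj (constSection e x))
  let B : X → ℝ := fun x => diffAt f (J.toZ (constSection e x).proj) (constSection e x).snd
  obtain ⟨_, _, hdec⟩ := exists_mfderiv_decomposition e
  have hA : MDifferentiableAt 𝓘(ℝ, EX) 𝓘(ℝ, ℝ) A e.proj := (hdec _ (hFd e)).1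
  have hB : MDifferentiableAt 𝓘(ℝ, EX) 𝓘(ℝ, ℝ) B e.proj :=
    (hdec _ ((contMDiff_diffAt f).mdifferentiable (by simp) e)).1
  -- `k₁` carries the difference of the derivatives of `F` and `\bar{df}` along the constant
  -- section; composing with the retraction makes it a function on `Z`.
  obtain ⟨k₁, -, hk₁⟩ := exists_smooth_mfderiv_eq e.proj
    (realDeriv 𝓘(ℝ, EX) (fun x => A x - B x) e.proj).toLinearMap
  obtain ⟨k, hk, -⟩ := exists_smooth_germ hr.isOpen hr.mem
    (k₁.contMDiff.comp_contMDiffOn hr.contMDiffOn)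
  refine ⟨f, k, hr.eventually.mono hf0, ?_⟩
  refine mfderiv_eq_of_fiber_of_section (hFd e) (mdifferentiableAt_jet f k e) ?_ ?_
  · let D : E →L[ℝ] ℝ := mfderiv 𝓘(ℝ, E) 𝓘(ℝ, ℝ) f (J.toZ e.proj)
    have h3 := fderiv_fiber_linear D (k (J.toZ e.proj)) e.snd
    have h4 : D = α := ContinuousLinearMap.coe_injective hf
    exact (h3.trans h4).symm
  · have h1 : (fun x => diffAt f (J.toZ (constSection e x).proj) (constSection e x).snd +
        k (J.toZ (constSection e x).proj)) =ᶠ[𝓝 e.proj] fun x => B x + k₁ x := by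
      filter_upwards [eventually_constSection_proj e, hr.eventually,
        J.toZ.contMDiff.continuous.continuousAt.eventually hk] with x hx1 hx2 hx3
      change B x + _ = B x + _
      rw [hx1, hx3, Function.comp_apply, hx2]
    have h2 : realDeriv 𝓘(ℝ, EX) k₁ e.proj = realDeriv 𝓘(ℝ, EX) (fun x => A x - B x) e.proj :=
      ContinuousLinearMap.coe_injective hk₁
    rw [realDeriv_sub hA hB] at h2
    have h3 := realDeriv_add hB (k₁.contMDiff.mdifferentiable (by simp) e.proj)
    rw [h2, add_sub_cancel] at h3
    exact h3.symm.trans (h1.mfderiv_eq).symm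

end Inclusions
end SternbergWeinstein

namespace SternbergWeinstein

/-! ### The bivector on covectors conormal to the leaf -/

section Poisson

variable {E Z : Type*} [NormedAddCommGroup E] [NormedSpace ℝ E] [TopologicalSpace Z]
  [ChartedSpace E Z]

theorem diffAt_mul (f h : C^∞⟮𝓘(ℝ, E), Z; ℝ⟯) (z : Z) :
    diffAt (f * h) z = f z • diffAt h z + h z • diffAt f z := by
  have h1 := (f.contMDiff.mdifferentiable (by simp) z).hasMFDerivAt.mul
    (h.contMDiff.mdifferentiable (by simp) z).hasMFDerivAt
  exact congrArg ContinuousLinearMap.toLinearMap h1.mfderiv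

theorem diffAt_add (f h : C^∞⟮𝓘(ℝ, E), Z; ℝ⟯) (z : Z) :
    diffAt (f + h) z = diffAt f z + diffAt h z := by
  have h1 := (f.contMDiff.mdifferentiable (by simp) z).hasMFDerivAt.add
    (h.contMDiff.mdifferentiable (by simp) z).hasMFDerivAt
  exact congrArg ContinuousLinearMap.toLinearMap h1.mfderiv

theorem PoissonStructure.bracket_antisymm (P : PoissonStructure E Z)
    (f h : C^∞⟮𝓘(ℝ, E), Z; ℝ⟯) : P.bracket f h = - P.bracket h f := by
  have h1 := P.bracket_self (f + h)
  simp only [map_add, LinearMap.add_apply, P.bracket_self, zero_add, add_zero] at h1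
  exact eq_neg_of_add_eq_zero_right h1

theorem PoissonStructure.bracket_one (P : PoissonStructure E Z) (h : C^∞⟮𝓘(ℝ, E), Z; ℝ⟯) :
    P.bracket 1 h = 0 := by
  have h1 := P.leibniz 1 1 h
  rw [one_mul, one_mul] at h1
  exact left_eq_add.1 h1

end Poisson

namespace Inclusions

variable {EX X ES S EQ Q E Z : Type*}
  [NormedAddCommGroup EX] [NormedSpace ℝ EX] [TopologicalSpace X] [ChartedSpace EX X]
  [NormedAddCommGroup ES] [NormedSpace ℝ ES] [TopologicalSpace S] [ChartedSpace ES S]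
  [NormedAddCommGroup EQ] [NormedSpace ℝ EQ] [TopologicalSpace Q] [ChartedSpace EQ Q]
  [NormedAddCommGroup E] [NormedSpace ℝ E] [TopologicalSpace Z] [ChartedSpace E Z]
  {J : Inclusions EX X ES S EQ Q E Z} {P : PoissonStructure E Z}
  {g : Type*} [LieRing g] [LieAlgebra ℝ g] {c : LieSubalgebra ℝ g} {x : X}

theorem AFiber_le_LFiber (x : X) : J.AFiber x ≤ J.LFiber x :=
  Submodule.dualAnnihilator_anti LinearMap.map_le_range

/-- The conormal directions `(TS)^0` are in the kernel of the bivector. -/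
theorem LieFrame.bracket_eq_zero [FiniteDimensional ℝ E] [T2Space Z] [IsManifold 𝓘(ℝ, E) ∞ Z]
    (a : J.LieFrame P g x) {f : C^∞⟮𝓘(ℝ, E), Z; ℝ⟯} (hf : diffAt f (J.toZ x) ∈ J.LFiber x)
    (m : C^∞⟮𝓘(ℝ, E), Z; ℝ⟯) : P.bracket f m (J.toZ x) = 0 := by
  -- Brackets with constants vanish, so `m` may be normalized to vanish at the point.
  obtain ⟨m', hm', hmm'⟩ : ∃ m' : C^∞⟮𝓘(ℝ, E), Z; ℝ⟯, m' (J.toZ x) = 0 ∧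
      P.bracket m' f = P.bracket m f := by
    refine ⟨m - m (J.toZ x) • 1, ?_, ?_⟩
    · change m (J.toZ x) - m (J.toZ x) * 1 = 0
      ring
    · simp [P.bracket_one]
  suffices h : P.bracket m' f (J.toZ x) = 0 by
    rw [P.bracket_antisymm, ← hmm']
    change -(P.bracket m' f (J.toZ x)) = 0
    rw [h, neg_zero]
  -- In dimension zero no function has nonzero differential, but `Z` is discrete and `m'` is a
  -- product of two functions vanishing at the point, so Leibniz suffices.
  rcases subsingleton_or_nontrivial E with hE | hE
  · have : DiscreteTopology Z := ChartedSpace.discreteTopology E Z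
    classical
    let i : C^∞⟮𝓘(ℝ, E), Z; ℝ⟯ := ⟨fun y => if y = J.toZ x then 0 else 1, contMDiff_of_discreteTopology⟩
    have hi : m' = m' * i := by
      ext y
      change m' y = m' y * (if y = J.toZ x then 0 else 1)
      split_ifs with h
      · rw [h, hm', zero_mul]
      · rw [mul_one]
    rw [hi, P.leibniz]
    change m' (J.toZ x) * P.bracket i f (J.toZ x) +
      (if J.toZ x = J.toZ x then (0 : ℝ) else 1) * P.bracket m' f (J.toZ x) = 0
    rw [hm', if_pos rfl, zero_mul, zero_mul, add_zero]
  · let ξ : g := a.1.symm ⟨_, hf⟩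
    have hξ : diffAt f (J.toZ x) = a.1 ξ := by simp [ξ]
    -- A product of two functions vanishing at the point has zero differential there, so it
    -- represents `0` in `g`. Well-definedness of the fibre bracket then forces this relation.
    -- Taking `k = l = u` with `du ≠ 0` gives `{u, f} = 0`, and then `l = u` gives `{k, f} = 0`.
    have key : ∀ k l : C^∞⟮𝓘(ℝ, E), Z; ℝ⟯, k (J.toZ x) = 0 → l (J.toZ x) = 0 →
        P.bracket l f (J.toZ x) • diffAt k (J.toZ x) + P.bracket k f (J.toZ x) • diffAt l (J.toZ x) = 0 := by
      intro k l hk hl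
      have h0 : diffAt (k * l) (J.toZ x) = a.1 (0 : g) := by
        rw [diffAt_mul, hk, hl, map_zero, zero_smul, zero_smul, add_zero]
        rfl
      have h1 := a.2 0 ξ (k * l) f h0 hξ
      rw [zero_lie, map_zero, P.leibniz, diffAt_add, diffAt_mul, diffAt_mul, hk, hl,
        zero_smul, zero_smul, zero_add, zero_add] at h1
      exact h1
    obtain ⟨v, hv⟩ := exists_ne (0 : E)
    obtain ⟨β, hβ⟩ : ∃ β : Module.Dual ℝ E, β v ≠ 0 := by
      by_contra! h
      exact hv ((Module.forall_dual_apply_eq_zero_iff ℝ v).1 h)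
    obtain ⟨u, hu0, hu⟩ := exists_smooth_mfderiv_eq (J.toZ x) β
    have huv : diffAt u (J.toZ x) v = β v := congrArg (fun L => L v) hu
    have h1 : P.bracket u f (J.toZ x) = 0 := by
      have h2 := congrArg (fun L => L v) (key u u hu0 hu0)
      have h3 : P.bracket u f (J.toZ x) * β v + P.bracket u f (J.toZ x) * β v = 0 :=
        huv ▸ h2
      have h4 : P.bracket u f (J.toZ x) * β v = 0 := by linarith
      exact (mul_eq_zero.1 h4).resolve_right hβ
    have h2 := key m' u hm' hu0
    rw [h1, zero_smul, zero_add] at h2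
    have h3 : P.bracket m' f (J.toZ x) * β v = 0 := huv ▸ congrArg (fun L => L v) h2
    exact (mul_eq_zero.1 h3).resolve_right hβ

/-! ### Constraint frames as linear coordinates on the fibres -/

variable (a : J.ConstraintFrame P c x)

theorem ConstraintFrame.pairing_quotMap (u : TangentSpace 𝓘(ℝ, EQ) (J.toQ x)) (ξ : g) :
    J.pairing x (Submodule.Quotient.mk u) (a.quotMap J (Submodule.Quotient.mk ξ)) =
      (a.1.1 ξ).1 (J.tangentQ x u) :=
  rfl

/-- The kernel is trivial because `a ξ` killing `TQ` means `ξ ∈ c`. For surjectivity, a linear left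
inverse of `tangentQ` extends covectors of `Q` to covectors of `Z`, still vanishing on `TS`. -/
theorem ConstraintFrame.quotMap_bijective
    (hQ : Function.Injective (J.tangentQ x)) : Function.Bijective (a.quotMap J) := by
  constructor
  · rw [injective_iff_map_eq_zero]
    intro ξ hξ
    induction ξ using Submodule.Quotient.induction_on with
    | H ξ =>
      rw [Submodule.Quotient.mk_eq_zero]
      refine (a.2 ξ).1 ?_
      refine (Submodule.mem_dualAnnihilator _).2 ?_
      rintro _ ⟨u, rfl⟩
      rw [← pairing_quotMap, hξ, map_zero]
  · intro l
    obtain ⟨q, hq⟩ := (J.tangentQ x).exists_leftInverse_of_injective (LinearMap.ker_eq_bot.2 hQ)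
    have hq' : ∀ u, q (J.tangentQ x u) = u := fun u => LinearMap.congr_fun hq u
    let l' : (J.TSinQ x).dualAnnihilator := l
    have hα : l'.1 ∘ₗ q ∈ J.LFiber x := by
      refine (Submodule.mem_dualAnnihilator _).2 ?_
      rintro _ ⟨u, hu, rfl⟩
      rw [LinearMap.comp_apply, hq']
      exact (Submodule.mem_dualAnnihilator _).1 l'.2 u hu
    refine ⟨Submodule.Quotient.mk (a.1.1.symm ⟨_, hα⟩), ?_⟩
    apply Subtype.ext
    refine LinearMap.ext fun u => ?_
    refine (a.pairing_quotMap u _).trans ?_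
    rw [LinearEquiv.apply_symm_apply]
    change l'.1 (q (J.tangentQ x u)) = l'.1 u
    rw [hq']

/-- The annihilator of `TS` is the dual of `TQ/TS`, so this is reflexivity of a finite-dimensional
space. -/
theorem pairing_surjective [FiniteDimensional ℝ EQ] (x : X) :
    Function.Surjective (J.pairing x) := by
  have : FiniteDimensional ℝ (TangentSpace 𝓘(ℝ, EQ) (J.toQ x)) :=
    inferInstanceAs (FiniteDimensional ℝ EQ)
  intro l
  let e := (J.TSinQ x).dualQuotEquivDualAnnihilator
  let l' : Module.Dual ℝ (Module.Dual ℝ (TangentSpace 𝓘(ℝ, EQ) (J.toQ x) ⧸ J.TSinQ x)) :=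
    l ∘ₗ e.toLinearMap
  obtain ⟨w, hw⟩ := (Module.evalEquiv ℝ _).surjective l'
  refine ⟨w, LinearMap.ext fun β => ?_⟩
  have h1 := LinearMap.congr_fun hw (e.symm β)
  have h2 : l' (e.symm β) = l β := congrArg l (e.apply_symm_apply β)
  rw [h2] at h1
  refine Eq.trans ?_ h1
  change (J.TSinQ x).dualCopairing β w = _
  rw [Submodule.dualCopairing_eq]
  rfl

/-- Every linear form on `g / c` is given by a vector tangent to `Q`. -/
theorem ConstraintFrame.exists_pairing_eq [FiniteDimensional ℝ EQ]
    (hQ : Function.Injective (J.tangentQ x)) (w : (g ⧸ c.toSubmodule) →ₗ[ℝ] ℝ) :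
    ∃ u : TangentSpace 𝓘(ℝ, EQ) (J.toQ x),
      J.pairing x (Submodule.Quotient.mk u) ∘ₗ a.quotMap J = w := by
  let e := LinearEquiv.ofBijective (a.quotMap J) (a.quotMap_bijective hQ)
  obtain ⟨u, hu⟩ := pairing_surjective (J := J) x (w ∘ₗ e.symm.toLinearMap)
  induction u using Submodule.Quotient.induction_on with
  | H u =>
    refine ⟨u, LinearMap.ext fun ξ => ?_⟩
    rw [hu]
    exact congrArg w (e.symm_apply_apply ξ)

theorem ConstraintFrame.exists_symMap_eq
    (hQ : Function.Injective (J.tangentQ x)) (s : SymmetricAlgebra ℝ (J.LQuotFiber x)) :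
    ∃ s', symMap (a.quotMap J) s' = s ∧
      ∀ i, s ∈ symPow (J.LQuotFiber x) i → s' ∈ symPow (g ⧸ c.toSubmodule) i := by
  let e := LinearEquiv.ofBijective (a.quotMap J) (a.quotMap_bijective hQ)
  refine ⟨symMap e.symm.toLinearMap s, ?_, fun i hi => symMap_mem_symPow _ i hi⟩
  have h1 : a.quotMap J ∘ₗ e.symm.toLinearMap = LinearMap.id :=
    LinearMap.ext fun ξ => e.apply_symm_apply ξ
  have h2 := symMap_comp (a.quotMap J) e.symm.toLinearMap
  rw [h1, symMap_id] at h2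
  exact (congrArg (fun f => f s) h2).symm

theorem evalSym_symMap (s' : SymmetricAlgebra ℝ (g ⧸ c.toSubmodule))
    (w : TangentSpace 𝓘(ℝ, EQ) (J.toQ x) ⧸ J.TSinQ x) :
    J.evalSym x (symMap (a.quotMap J) s') w =
      SymmetricAlgebra.lift (J.pairing x w ∘ₗ a.quotMap J) s' :=
  lift_symMap _ _ _

end Inclusions
end SternbergWeinstein

namespace SternbergWeinstein

namespace Inclusions

variable {EX X ES S EQ Q E Z : Type*}
  [NormedAddCommGroup EX] [NormedSpace ℝ EX] [TopologicalSpace X] [ChartedSpace EX X]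
  [NormedAddCommGroup ES] [NormedSpace ℝ ES] [TopologicalSpace S] [ChartedSpace ES S]
  [NormedAddCommGroup EQ] [NormedSpace ℝ EQ] [TopologicalSpace Q] [ChartedSpace EQ Q]
  [NormedAddCommGroup E] [NormedSpace ℝ E] [TopologicalSpace Z] [ChartedSpace E Z]
  {J : Inclusions EX X ES S EQ Q E Z} {P : PoissonStructure E Z}
  {g : Type*} [LieRing g] [LieAlgebra ℝ g] {c : LieSubalgebra ℝ g} {x : X}

/-! ### The bracket of a fibrewise polynomial function with a constraint -/

section Jets

variable [IsManifold 𝓘(ℝ, E) ∞ Z]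

/-- The derivative along the fibres of `TQ|_X / TX` of a function on `TZ|_X / TX` is given by the
differentials occurring in its jets. -/
theorem IsFirstJet.hasDerivAt_fiber {F : J.EDual → ℝ} (hF : NormalBundle.IsSmooth F)
    {v : TangentSpace 𝓘(ℝ, EQ) (J.toQ x)} {f k : C^∞⟮𝓘(ℝ, E), Z; ℝ⟯}
    (h : J.IsFirstJet F (PullbackTangent.mk J.toZ x (J.tangentQ x v)) f k)
    (u : TangentSpace 𝓘(ℝ, EQ) (J.toQ x)) :
    HasDerivAt (fun t : ℝ => F (J.inclQ' (NormalBundle.proj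
      (PullbackTangent.mk J.toQ x (v + t • u))))) (diffAt f (J.toZ x) (J.tangentQ x u)) 0 := by
  have h1 := h.diffAt_eq hF (J.tangentQ x u)
  let v' : E := J.tangentQ x v
  let u' : E := J.tangentQ x u
  have h2 := (differentiableAt_fiber (ContMDiff.mdifferentiable hF (by simp)
    (PullbackTangent.mk J.toZ x (J.tangentQ x v)))).hasFDerivAt.hasLineDerivAt u'
  have h3 : HasDerivAt (fun t : ℝ => F (NormalBundle.proj
    (PullbackTangent.mk J.toZ x (v' + t • u')))) (diffAt f (J.toZ x) (J.tangentQ x u)) 0 :=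
    h1 ▸ h2
  refine h3.congr_of_eventuallyEq (.of_eq (funext fun t => ?_))
  rw [inclQ'_proj, map_add, map_smul]
  rfl

/-- The value at a point of `TQ|_X / TX` of the differential occurring in a jet of an extension of
a vertically polynomial function. -/
theorem IsFirstJet.diffAt_eq_symDeriv {F : J.EDual → ℝ} (hF : NormalBundle.IsSmooth F)
    {s : ∀ x, SymmetricAlgebra ℝ (J.LQuotFiber x)} (hFs : F ∘ J.inclQ' = J.sectionFun s ∘ J.projL)
    (a : J.ConstraintFrame P c x) {s' : SymmetricAlgebra ℝ (g ⧸ c.toSubmodule)}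
    (hs : symMap (a.quotMap J) s' = s x)
    {v : TangentSpace 𝓘(ℝ, EQ) (J.toQ x)} {f k : C^∞⟮𝓘(ℝ, E), Z; ℝ⟯}
    (h : J.IsFirstJet F (PullbackTangent.mk J.toZ x (J.tangentQ x v)) f k)
    (u : TangentSpace 𝓘(ℝ, EQ) (J.toQ x)) :
    diffAt f (J.toZ x) (J.tangentQ x u) = symDeriv s'
      (J.pairing x (Submodule.Quotient.mk v) ∘ₗ a.quotMap J)
      (J.pairing x (Submodule.Quotient.mk u) ∘ₗ a.quotMap J) := by
  refine (h.hasDerivAt_fiber hF u).unique ?_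
  have h1 : ∀ t : ℝ, F (J.inclQ' (NormalBundle.proj (PullbackTangent.mk J.toQ x (v + t • u)))) =
      SymmetricAlgebra.lift
        (J.pairing x (Submodule.Quotient.mk (v + t • u)) ∘ₗ a.quotMap J) s' := by
    intro t
    refine (congrFun hFs _).trans ?_
    rw [← evalSym_symMap, hs]
    rfl
  simp only [h1]
  have h2 := hasDerivAt_lift (t := 0) (w' := J.pairing x (Submodule.Quotient.mk u) ∘ₗ a.quotMap J)
    (w := fun t : ℝ => J.pairing x (Submodule.Quotient.mk (v + t • u)) ∘ₗ a.quotMap J) s' ?_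
  · simpa using h2
  · intro ξ
    induction ξ using Submodule.Quotient.induction_on with
    | H ξ =>
      simp only [LinearMap.comp_apply, ConstraintFrame.pairing_quotMap, map_add, map_smul,
        smul_eq_mul]
      simpa using ((hasDerivAt_id (0 : ℝ)).mul_const ((a.1.1 ξ).1 (J.tangentQ x u))).const_add
        ((a.1.1 ξ).1 (J.tangentQ x v))

theorem IsFirstJet.diffAt_mem_AFiber {G : J.EDual → ℝ} (hG : G ∈ J.constraints)
    {v : TangentSpace 𝓘(ℝ, EQ) (J.toQ x)} {h m : C^∞⟮𝓘(ℝ, E), Z; ℝ⟯}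
    (hj : J.IsFirstJet G (PullbackTangent.mk J.toZ x (J.tangentQ x v)) h m) :
    diffAt h (J.toZ x) ∈ J.AFiber x := by
  refine (Submodule.mem_dualAnnihilator _).2 ?_
  rintro _ ⟨u, rfl⟩
  refine (hj.hasDerivAt_fiber hG.1 u).unique ?_
  simp only [hG.2]
  exact hasDerivAt_const _ _

variable [FiniteDimensional ℝ EQ] [FiniteDimensional ℝ E] [T2Space Z]

/-- The Poisson bracket of an extension of a vertically polynomial function and a constraint. -/
theorem bracket_jets_eq {F G : J.EDual → ℝ} (hF : NormalBundle.IsSmooth F) (hG : G ∈ J.constraints)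
    {s : ∀ x, SymmetricAlgebra ℝ (J.LQuotFiber x)} (hFs : F ∘ J.inclQ' = J.sectionFun s ∘ J.projL)
    (hQ : Function.Injective (J.tangentQ x))
    (a : J.ConstraintFrame P c x) {s' : SymmetricAlgebra ℝ (g ⧸ c.toSubmodule)}
    (hs : symMap (a.quotMap J) s' = s x)
    {v : TangentSpace 𝓘(ℝ, EQ) (J.toQ x)} {f k h m : C^∞⟮𝓘(ℝ, E), Z; ℝ⟯}
    (hf : J.IsFirstJet F (PullbackTangent.mk J.toZ x (J.tangentQ x v)) f k)
    (hh : J.IsFirstJet G (PullbackTangent.mk J.toZ x (J.tangentQ x v)) h m) :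
    ∃ η : c, (a.1.1 η).1 = diffAt h (J.toZ x) ∧
      diffAt (P.bracket f h) (J.toZ x) (J.tangentQ x v) + P.bracket f m (J.toZ x) -
        P.bracket h k (J.toZ x) =
      -symDeriv s' (J.pairing x (Submodule.Quotient.mk v) ∘ₗ a.quotMap J)
        ((J.pairing x (Submodule.Quotient.mk v) ∘ₗ a.quotMap J) ∘ₗ adQuot c η) := by
  have hhA := hh.diffAt_mem_AFiber hG
  have hhL := AFiber_le_LFiber x hhA
  have hfu := hf.diffAt_eq_symDeriv hF hFs a hs
  have hfL : diffAt f (J.toZ x) ∈ J.LFiber x := by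
    refine (Submodule.mem_dualAnnihilator _).2 ?_
    rintro _ ⟨u, hu, rfl⟩
    refine (hf.hasDerivAt_fiber hF u).unique ?_
    have h1 : ∀ t : ℝ, F (J.inclQ' (NormalBundle.proj (PullbackTangent.mk J.toQ x (v + t • u)))) =
        F (J.inclQ' (NormalBundle.proj (PullbackTangent.mk J.toQ x v))) := by
      intro t
      refine (congrFun hFs _).trans (Eq.trans ?_ (congrFun hFs _).symm)
      have h2 : v + t • u - v ∈ J.TSinQ x := by
        rw [add_sub_cancel_left]
        exact Submodule.smul_mem _ t hu
      exact congrArg (J.sectionFun s) (NormalBundle.proj_mk_eq_iff (p := J.toQ).2 h2)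
    simp only [h1]
    exact hasDerivAt_const _ _
  let ξ : g := a.1.1.symm ⟨_, hfL⟩
  let η : g := a.1.1.symm ⟨_, hhL⟩
  have hξ : (a.1.1 ξ).1 = diffAt f (J.toZ x) := by simp [ξ]
  have hη : (a.1.1 η).1 = diffAt h (J.toZ x) := by simp [η]
  have hηc : η ∈ c := (a.2 η).1 (hη ▸ hhA)
  refine ⟨⟨η, hηc⟩, hη, ?_⟩
  rw [a.1.bracket_eq_zero hfL, a.1.bracket_eq_zero hhL, add_zero, sub_zero,
    a.1.2 ξ η f h hξ.symm hη.symm]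
  -- Realize the direction `w ∘ ad η` by a vector `u` tangent to `Q`; the derivative of `s'` in that
  -- direction is then `df(u) = w [η, ξ]`, which is the bracket value up to sign.
  obtain ⟨u, hu⟩ := a.exists_pairing_eq hQ
    ((J.pairing x (Submodule.Quotient.mk v) ∘ₗ a.quotMap J) ∘ₗ adQuot c ⟨η, hηc⟩)
  rw [← hu, ← hfu, ← hξ, ← a.pairing_quotMap, ← a.pairing_quotMap]
  have h2 := LinearMap.congr_fun hu (Submodule.Quotient.mk ξ)
  rw [LinearMap.comp_apply] at h2
  rw [h2]
  change _ = -(J.pairing x (Submodule.Quotient.mk v)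
    (a.quotMap J (Submodule.Quotient.mk ⁅η, ξ⁆)))
  rw [← lie_skew, Submodule.Quotient.mk_neg, map_neg, map_neg]

end Jets

variable [IsManifold 𝓘(ℝ, EQ) ∞ Q] [FiniteDimensional ℝ E] [T2Space Z] [IsManifold 𝓘(ℝ, E) ∞ Z]

/-- Conormal vectors of `Q` are vertical differentials of constraints. -/
theorem exists_constraint (hQ : Manifold.IsSmoothEmbedding 𝓘(ℝ, EQ) 𝓘(ℝ, E) ∞ J.iQ)
    {α : Module.Dual ℝ (TangentSpace 𝓘(ℝ, E) (J.toZ x))} (hα : α ∈ J.AFiber x) :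
    ∃ G ∈ J.constraints, ∀ (e : PullbackTangent J.toZ) (_ : e.proj = x)
      (h m : C^∞⟮𝓘(ℝ, E), Z; ℝ⟯), J.IsFirstJet G e h m → diffAt h (J.toZ x) = α := by
  obtain ⟨U, r, hr⟩ := exists_retraction_iQ hQ (J.toQ x)
  -- Here `Q` must be embedded and not just immersed: a neighbourhood in `Q` is cut out by an open
  -- set `W` of `Z`, so a function supported in `W` can vanish on all of `Q`.
  obtain ⟨W, hW, hWr⟩ : ∃ W : Set Z, IsOpen W ∧ J.iQ (J.toQ x) ∈ W ∧
      ∀ q, J.iQ q ∈ W → r (J.iQ q) = q := by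
    have h1 := hr.eventually
    rw [hQ.isEmbedding.nhds_eq_comap, eventually_comap] at h1
    obtain ⟨W, hW, hWo, hxW⟩ := eventually_nhds_iff.1 h1
    exact ⟨W, hWo, hxW, fun q hq => hW _ hq q rfl⟩
  obtain ⟨f, hf, hfW, hf0⟩ := exists_smooth_vanishing hr J.iQ.contMDiff hW hWr.1 α
    fun v => (Submodule.mem_dualAnnihilator _).1 hα _ ⟨v, rfl⟩
  have hfQ : ∀ q, f (J.iQ q) = 0 := by
    intro q
    by_cases hq : J.iQ q ∈ W
    · exact hf0 q (hWr.2 q hq)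
    · exact hfW _ hq
  have hfT : ∀ y (v : TangentSpace 𝓘(ℝ, EQ) (J.toQ y)),
      diffAt f (J.toZ y) (J.tangentQ y v) = 0 := by
    intro y v
    have h1 := mfderiv_comp (J.toQ y) (f.contMDiff.mdifferentiable (by simp) (J.iQ (J.toQ y)))
      (J.iQ.contMDiff.mdifferentiable (by simp) _)
    have h2 : (f ∘ J.iQ : Q → ℝ) = fun _ => 0 := funext hfQ
    rw [h2, mfderiv_const] at h1
    exact (congrArg (fun L => L v) h1).symm
  have hfX : ∀ y, J.TX y ≤ LinearMap.ker (diffAt f (J.toZ y)) := by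
    rintro y _ ⟨v, -, rfl⟩
    exact hfT y v
  -- `G` is the fibrewise linear function `\bar{df}`, which descends because `df` kills `TQ ⊇ TX`
  -- along `X`.
  let G : J.EDual → ℝ := fun ξ => (J.TX ξ.1).liftQ (diffAt f (J.toZ ξ.1)) (hfX ξ.1) ξ.2
  have hG : NormalBundle.IsSmooth G := contMDiff_diffAt f
  refine ⟨G, ⟨hG, ?_⟩, ?_⟩
  · rintro ⟨y, v⟩
    obtain ⟨v, rfl⟩ := (J.TXinQ y).mkQ_surjective v
    exact hfT y v
  · rintro e rfl h m hj
    refine LinearMap.ext fun v => ?_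
    rw [hj.diffAt_eq hG]
    let D : E →L[ℝ] ℝ := mfderiv 𝓘(ℝ, E) 𝓘(ℝ, ℝ) f (J.toZ e.proj)
    have h1 : fderiv ℝ D e.snd = D := D.fderiv
    exact (congrArg (fun L : E →L[ℝ] ℝ => L v) h1).trans (congrArg (fun L => L v) hf)

variable [FiniteDimensional ℝ EX] [T2Space X] [SigmaCompactSpace X] [IsManifold 𝓘(ℝ, EX) ∞ X]
  [IsManifold 𝓘(ℝ, ES) ∞ S] [FiniteDimensional ℝ EQ]

/-- A vertically polynomial function is reduced iff its fibrewise polynomials are infinitesimally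
invariant; it is enough to test this in one frame at each point. -/
theorem mem_reducedAlgebra
    (hS : P.IsSymplecticLeaf (EM := ES) (fun s => J.iQ (J.iS s)))
    (hX : Manifold.IsSmoothEmbedding 𝓘(ℝ, EX) 𝓘(ℝ, ES) ∞ J.iX)
    (hQ : Manifold.IsSmoothEmbedding 𝓘(ℝ, EQ) 𝓘(ℝ, E) ∞ J.iQ)
    {s : ∀ x, SymmetricAlgebra ℝ (J.LQuotFiber x)} (hs : NormalBundle.IsSmooth (J.sectionFun s)) :
    (J.sectionFun s ∘ J.projL ∈ J.reducedAlgebra P →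
      ∀ (x : X) (a : J.ConstraintFrame P c x) (s' : SymmetricAlgebra ℝ (g ⧸ c.toSubmodule)),
        symMap (a.quotMap J) s' = s x → IsInfInvariant c s') ∧
    ((∀ x : X, ∃ (a : J.ConstraintFrame P c x) (s' : SymmetricAlgebra ℝ (g ⧸ c.toSubmodule)),
        symMap (a.quotMap J) s' = s x ∧ IsInfInvariant c s') →
      J.sectionFun s ∘ J.projL ∈ J.reducedAlgebra P) := by
  have hjet : ∀ {F : J.EDual → ℝ}, NormalBundle.IsSmooth F → ∀ e : PullbackTangent J.toZ,
      ∃ f k, J.IsFirstJet F e f k := by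
    intro F hF e
    obtain ⟨U, r, hr⟩ := exists_retraction_toZ hS hX e.proj
    exact exists_isFirstJet hF hr
  -- The value of `swBracket` comes from an unspecified choice of lift and jets. Such a choice
  -- exists, and the formula is shown to hold for whichever one is made.
  have hspec : ∀ {F G : J.EDual → ℝ}, NormalBundle.IsSmooth F → G ∈ J.constraints →
      F ∘ J.inclQ' = J.sectionFun s ∘ J.projL → ∀ (x : X) (a : J.ConstraintFrame P c x)
      (s' : SymmetricAlgebra ℝ (g ⧸ c.toSubmodule)), symMap (a.quotMap J) s' = s x →
      ∀ v : TangentSpace 𝓘(ℝ, EQ) (J.toQ x), ∃ (e : PullbackTangent J.toZ) (h m : C^∞⟮𝓘(ℝ, E), Z; ℝ⟯)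
        (η : c), e.proj = x ∧ J.IsFirstJet G e h m ∧ (a.1.1 η).1 = diffAt h (J.toZ x) ∧
        J.swBracket P F G (J.inclQ' (NormalBundle.proj (PullbackTangent.mk J.toQ x v))) =
      -symDeriv s' (J.pairing x (Submodule.Quotient.mk v) ∘ₗ a.quotMap J)
        ((J.pairing x (Submodule.Quotient.mk v) ∘ₗ a.quotMap J) ∘ₗ adQuot c η) := by
    intro F G hF hG hFs x a s' hs' v
    obtain ⟨f, k, hfk⟩ := hjet hF (PullbackTangent.mk J.toZ x (J.tangentQ x v))
    obtain ⟨h, m, hhm⟩ := hjet hG.1 (PullbackTangent.mk J.toZ x (J.tangentQ x v))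
    have hex : ∃ (r : ℝ) (e : PullbackTangent J.toZ) (f k h m : C^∞⟮𝓘(ℝ, E), Z; ℝ⟯),
      NormalBundle.proj e = J.inclQ' (NormalBundle.proj (PullbackTangent.mk J.toQ x v)) ∧
      J.IsFirstJet F e f k ∧ J.IsFirstJet G e h m ∧
      r = diffAt (P.bracket f h) (J.toZ e.proj) e.snd
        + P.bracket f m (J.toZ e.proj) - P.bracket h k (J.toZ e.proj) :=
      ⟨_, _, f, k, h, m, rfl, hfk, hhm, rfl⟩
    obtain ⟨e, f, k, h, m, he, hf, hh, hr⟩ := Classical.epsilon_spec hex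
    obtain ⟨u, hu, rfl⟩ := proj_eq_inclQ'_iff.1 he
    obtain ⟨η, hη, hval⟩ := bracket_jets_eq hF hG hFs (tangentQ_injective hQ x) a hs' hf hh
    -- The chosen lift differs from `v` by a vector of `TX ⊆ TS`, which does not affect the linear
    -- form on `g/c`.
    have hvu : (Submodule.Quotient.mk (v + u) : TangentSpace 𝓘(ℝ, EQ) (J.toQ x) ⧸ J.TSinQ x) =
        Submodule.Quotient.mk v := by
      rw [Submodule.Quotient.eq, add_sub_cancel_left]
      exact J.TXinQ_le_TSinQ x hu
    rw [hvu] at hval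
    exact ⟨_, h, m, η, rfl, hh, hη, hr.trans hval⟩
  constructor
  · rintro ⟨F, ⟨hF, hadm⟩, hFs⟩ x a s' hs' η w
    obtain ⟨v, rfl⟩ := a.exists_pairing_eq (tangentQ_injective hQ x) w
    -- All jets of this `G` over `x` have differential `a η`, so the element of `c` produced by the
    -- unknown choice must be `η` itself.
    obtain ⟨G, hG, hGd⟩ := exists_constraint hQ ((a.2 η).2 η.2)
    obtain ⟨e, h, m, η', he, hh, hη', hval⟩ := hspec hF hG hFs.symm x a s' hs' v
    rw [hadm G hG, hGd e he h m hh] at *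
    have h1 : η' = η := Subtype.ext (a.1.1.injective (Subtype.ext hη'))
    rw [h1] at hval
    exact neg_eq_zero.1 hval.symm
  · intro hinv
    obtain ⟨F, hF, hFs⟩ := exists_smooth_extension hQ (isSmooth_comp_projL hs)
    refine ⟨F, ⟨hF, fun G hG ξ => ?_⟩, hFs.symm⟩
    obtain ⟨x, v⟩ := ξ
    obtain ⟨v, rfl⟩ := (J.TXinQ x).mkQ_surjective v
    obtain ⟨a, s', hs', hinv'⟩ := hinv x
    obtain ⟨e, h, m, η, -, -, -, hval⟩ := hspec hF hG hFs x a s' hs' v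
    refine hval.trans ?_
    rw [hinv' η, neg_zero]

end Inclusions
end SternbergWeinstein

namespace SternbergWeinstein

/-! ### Homogeneous parts of invariants, and degree one -/

section Invariants

variable {g : Type*} [LieRing g] [LieAlgebra ℝ g] {c : LieSubalgebra ℝ g}

theorem symDeriv_ι {V : Type*} [AddCommGroup V] [Module ℝ V] (v : V) (w w' : V →ₗ[ℝ] ℝ) :
    symDeriv (SymmetricAlgebra.ι ℝ V v) w w' = w' v := by
  simp [symDeriv, snd_dualJet]

theorem symPow_one (V : Type*) [AddCommGroup V] [Module ℝ V] :
    symPow V 1 = LinearMap.range (SymmetricAlgebra.ι ℝ V) :=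
  pow_one _

theorem ι_injective (V : Type*) [AddCommGroup V] [Module ℝ V] :
    Function.Injective (SymmetricAlgebra.ι ℝ V) := by
  rw [injective_iff_map_eq_zero]
  intro v hv
  refine (Module.forall_dual_apply_eq_zero_iff ℝ v).1 fun w => ?_
  rw [← SymmetricAlgebra.lift_ι_apply w v, hv, map_zero]

theorem isInfInvariant_sum {ι : Type*} (I : Finset ι)
    {s : ι → SymmetricAlgebra ℝ (g ⧸ c.toSubmodule)} (h : ∀ i ∈ I, IsInfInvariant c (s i)) :
    IsInfInvariant c (∑ i ∈ I, s i) := by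
  intro ξ w
  rw [symDeriv_sum]
  exact Finset.sum_eq_zero fun i hi => h i hi ξ w

/-- The condition is tested at `j • w` for `j = 0, …, d`; the degree `k` part scales by `j ^ k`, and
a combination of these tests isolates degree `i`. -/
theorem IsInfInvariant.of_sum {d : ℕ} {s : ℕ → SymmetricAlgebra ℝ (g ⧸ c.toSubmodule)}
    (hs : ∀ i, s i ∈ symPow (g ⧸ c.toSubmodule) i)
    (h : IsInfInvariant c (∑ i ∈ Finset.range (d + 1), s i)) {i : ℕ} (hi : i < d + 1) :
    IsInfInvariant c (s i) := by
  intro ξ w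
  obtain ⟨C, hC⟩ := exists_separating_coeff d i hi
  have h1 : ∀ j : Fin (d + 1), ∑ k ∈ Finset.range (d + 1),
      ((j : ℕ) : ℝ) ^ k * symDeriv (s k) w (w ∘ₗ adQuot c ξ) = 0 := by
    intro j
    have h2 := h ξ (((j : ℕ) : ℝ) • w)
    rw [symDeriv_sum] at h2
    rw [← h2]
    refine Finset.sum_congr rfl fun k _ => ?_
    rw [LinearMap.smul_comp, symDeriv_smul_of_mem_symPow _ _ _ (hs k)]
  have h2 : ∑ j, C j * ∑ k ∈ Finset.range (d + 1),
      ((j : ℕ) : ℝ) ^ k * symDeriv (s k) w (w ∘ₗ adQuot c ξ) = 0 :=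
    Finset.sum_eq_zero fun j _ => by rw [h1, mul_zero]
  simp only [Finset.mul_sum, ← mul_assoc] at h2
  rw [Finset.sum_comm] at h2
  simp only [← Finset.sum_mul] at h2
  rw [Finset.sum_congr rfl fun k hk => by rw [hC k (Finset.mem_range.1 hk)]] at h2
  simpa [hi] using h2

variable [FiniteDimensional ℝ g]

theorem mem_symInv_iff_isInfInvariant (c : LieSubalgebra ℝ g) (i : ℕ)
    (s : SymmetricAlgebra ℝ (g ⧸ c.toSubmodule)) :
    s ∈ symInv c i ↔ s ∈ symPow (g ⧸ c.toSubmodule) i ∧ IsInfInvariant c s := by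
  rw [mem_symInv, isInfInvariant_iff]

theorem symInv_one_eq (c : LieSubalgebra ℝ g) :
    symInv c 1 = (redLieAlg c).map (SymmetricAlgebra.ι ℝ (g ⧸ c.toSubmodule)) := by
  -- A linear polynomial has derivative independent of the point, so the condition is that every
  -- linear form vanishes on `[ξ, v]` modulo `c`.
  have key : ∀ v : g, IsInfInvariant c (SymmetricAlgebra.ι ℝ _
      (Submodule.Quotient.mk v : g ⧸ c.toSubmodule)) ↔ v ∈ c.normalizer := by
    intro v
    have h1 : IsInfInvariant c (SymmetricAlgebra.ι ℝ _
        (Submodule.Quotient.mk v : g ⧸ c.toSubmodule)) ↔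
        ∀ ξ : c, adQuot c ξ (Submodule.Quotient.mk v) = 0 := by
      refine forall_congr' fun ξ => ?_
      simp only [symDeriv_ι]
      exact Module.forall_dual_apply_eq_zero_iff ℝ _
    rw [h1, LieSubalgebra.mem_normalizer_iff']
    constructor
    · intro h y hy
      exact (Submodule.Quotient.mk_eq_zero _).1 (h ⟨y, hy⟩)
    · intro h ξ
      exact (Submodule.Quotient.mk_eq_zero _).2 (h ξ ξ.2)
  ext s
  rw [mem_symInv_iff_isInfInvariant, symPow_one]
  constructor
  · rintro ⟨⟨v, rfl⟩, h⟩
    induction v using Submodule.Quotient.induction_on with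
    | H v => exact ⟨_, ⟨v, (key v).1 h, rfl⟩, rfl⟩
  · rintro ⟨_, ⟨v, hv, rfl⟩, rfl⟩
    exact ⟨⟨_, rfl⟩, (key v).2 hv⟩

end Invariants

/-! ### Smooth homogeneous components and associated bundles -/

namespace Inclusions

variable {EX X ES S EQ Q E Z : Type*}
  [NormedAddCommGroup EX] [NormedSpace ℝ EX] [TopologicalSpace X] [ChartedSpace EX X]
  [NormedAddCommGroup ES] [NormedSpace ℝ ES] [TopologicalSpace S] [ChartedSpace ES S]
  [NormedAddCommGroup EQ] [NormedSpace ℝ EQ] [TopologicalSpace Q] [ChartedSpace EQ Q]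
  [NormedAddCommGroup E] [NormedSpace ℝ E] [TopologicalSpace Z] [ChartedSpace E Z]
  {J : Inclusions EX X ES S EQ Q E Z} {P : PoissonStructure E Z}
  {g : Type*} [LieRing g] [LieAlgebra ℝ g] {c : LieSubalgebra ℝ g}

theorem evalSym_smul {x : X} {i : ℕ} {s : SymmetricAlgebra ℝ (J.LQuotFiber x)}
    (hs : s ∈ symPow (J.LQuotFiber x) i) (r : ℝ)
    (w : TangentSpace 𝓘(ℝ, EQ) (J.toQ x) ⧸ J.TSinQ x) :
    J.evalSym x s (r • w) = r ^ i * J.evalSym x s w := by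
  have h : J.pairing x (r • w) = r • J.pairing x w := map_smul _ _ _
  rw [evalSym, h, lift_smul_of_mem_symPow _ r hs]
  rfl

theorem sectionFun_smul {i : ℕ} {s : ∀ x, SymmetricAlgebra ℝ (J.LQuotFiber x)}
    (hs : ∀ x, s x ∈ symPow (J.LQuotFiber x) i) (r : ℝ) (x : X)
    (v : TangentSpace 𝓘(ℝ, EQ) (J.toQ x)) :
    J.sectionFun s (NormalBundle.proj (PullbackTangent.mk J.toQ x (r • v))) =
      r ^ i * J.sectionFun s (NormalBundle.proj (PullbackTangent.mk J.toQ x v)) := by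
  change J.evalSym x (s x) ((J.TSinQ x).mkQ (r • v)) = r ^ i * J.evalSym x (s x) ((J.TSinQ x).mkQ v)
  rw [map_smul, evalSym_smul (hs x)]

theorem sectionFun_sum {ι : Type*} (I : Finset ι)
    (s : ι → ∀ x, SymmetricAlgebra ℝ (J.LQuotFiber x)) :
    J.sectionFun (fun x => ∑ i ∈ I, s i x) = ∑ i ∈ I, J.sectionFun (s i) := by
  funext w
  rw [Finset.sum_apply]
  exact map_sum _ _ _

section Smooth

variable [IsManifold 𝓘(ℝ, EQ) ∞ Q]

theorem isSmooth_sum {ι : Type*} (I : Finset ι) {h : ι → J.LQuotDual → ℝ}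
    (hh : ∀ i ∈ I, NormalBundle.IsSmooth (h i)) : NormalBundle.IsSmooth (∑ i ∈ I, h i) := by
  have h1 : ContMDiff (𝓘(ℝ, EX).prod 𝓘(ℝ, EQ)) 𝓘(ℝ, ℝ) ∞
      (fun e : PullbackTangent J.toQ => ∑ i ∈ I, h i (NormalBundle.proj e)) :=
    contMDiff_finsetSum hh
  rw [NormalBundle.IsSmooth]
  simpa only [Finset.sum_apply] using h1

/-- The homogeneous parts of a smooth vertically polynomial function are smooth. -/
theorem isSmooth_homogeneous {d : ℕ} {s : ∀ (_ : ℕ) (x : X), SymmetricAlgebra ℝ (J.LQuotFiber x)}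
    (hs : ∀ i x, s i x ∈ symPow (J.LQuotFiber x) i)
    (h : NormalBundle.IsSmooth (∑ i ∈ Finset.range (d + 1), J.sectionFun (s i)))
    {i : ℕ} (hi : i < d + 1) : NormalBundle.IsSmooth (J.sectionFun (s i)) := by
  obtain ⟨C, hC⟩ := exists_separating_coeff d i hi
  obtain ⟨H, hH⟩ : ∃ H, H = ∑ i ∈ Finset.range (d + 1), J.sectionFun (s i) := ⟨_, rfl⟩
  have hH' : ∀ w, H w = ∑ k ∈ Finset.range (d + 1), J.sectionFun (s k) w := fun w => by
    rw [hH, Finset.sum_apply]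
  rw [← hH] at h
  -- The homogeneous part is a fixed linear combination of the total function composed with
  -- fibrewise rescalings, which are smooth.
  have h1 : ∀ e : PullbackTangent J.toQ, J.sectionFun (s i) (NormalBundle.proj e) =
      ∑ j, C j * H (NormalBundle.proj
        (PullbackTangent.mk J.toQ e.proj (((j : ℕ) : ℝ) • e.snd))) := by
    intro e
    have h2 : ∀ r : ℝ, H (NormalBundle.proj (PullbackTangent.mk J.toQ e.proj (r • e.snd))) =
        ∑ k ∈ Finset.range (d + 1), r ^ k * J.sectionFun (s k) (NormalBundle.proj e) := by
      intro r
      exact (hH' _).trans (Finset.sum_congr rfl fun k _ => sectionFun_smul (hs k) r e.proj e.snd)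
    simp only [h2, Finset.mul_sum, ← mul_assoc]
    rw [Finset.sum_comm]
    simp only [← Finset.sum_mul]
    rw [Finset.sum_congr rfl fun k hk => by rw [hC k (Finset.mem_range.1 hk)]]
    simp [hi]
  have h' : ContMDiff (𝓘(ℝ, EX).prod 𝓘(ℝ, EQ)) 𝓘(ℝ, ℝ) ∞
      (fun e : PullbackTangent J.toQ => H (NormalBundle.proj e)) := h
  have h2 : ContMDiff (𝓘(ℝ, EX).prod 𝓘(ℝ, EQ)) 𝓘(ℝ, ℝ) ∞
      (fun e : PullbackTangent J.toQ => ∑ j, C j * H (NormalBundle.proj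
        (PullbackTangent.mk J.toQ e.proj (((j : ℕ) : ℝ) • e.snd)))) :=
    contMDiff_finsetSum fun j _ => contMDiff_const.mul
      (h'.comp (contMDiff_pullbackTangent_smul _))
  rw [NormalBundle.IsSmooth, funext h1]
  exact h2

end Smooth

variable [FiniteDimensional ℝ g]

theorem AssocFiber.exists_rep {x : X} {i : ℕ} (σ : J.AssocFiber P c x i) :
    ∃ (a : J.ConstraintFrame P c x) (s' : SymmetricAlgebra ℝ (g ⧸ c.toSubmodule)),
      s' ∈ symInv c i ∧ symMap (a.quotMap J) s' = σ.toSym J := by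
  induction σ using Quot.ind with
  | mk p =>
    obtain ⟨r, s'⟩ := p
    induction r using Quot.ind with
    | mk a => exact ⟨a, s'.1, s'.2, rfl⟩

/-- The frames may be chosen independently at each point: smoothness is a condition on the resulting
function, not on the chosen representatives. -/
theorem sectionFun_mem_assocFun [IsManifold 𝓘(ℝ, EQ) ∞ Q] {i : ℕ}
    {s : ∀ x, SymmetricAlgebra ℝ (J.LQuotFiber x)} (h : NormalBundle.IsSmooth (J.sectionFun s))
    (hs : ∀ x, ∃ (a : J.ConstraintFrame P c x) (s' : SymmetricAlgebra ℝ (g ⧸ c.toSubmodule)),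
      s' ∈ symInv c i ∧ symMap (a.quotMap J) s' = s x) :
    J.sectionFun s ∈ J.assocFun P c i := by
  choose a s' hs' hs using hs
  refine ⟨h, fun x => Quot.mk _ (Quot.mk _ (a x), ⟨s' x, hs' x⟩), ?_⟩
  congr 1
  funext x
  exact (hs x).symm

/-- The fibre of the first associated bundle, in terms of the reduced Lie algebra. -/
theorem exists_redAssocFiber_equiv (x : X) :
    ∃ Φ : J.RedAssocFiber P c x ≃ J.AssocFiber P c x 1,
      ∀ (a : J.ConstraintFrame P c x) (η : redLieAlg c),
        (Φ (Quot.mk _ (Quot.mk _ a, η))).toSym J =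
          SymmetricAlgebra.ι ℝ (J.LQuotFiber x) (a.quotMap J η) := by
  have hmem : ∀ η : redLieAlg c, SymmetricAlgebra.ι ℝ (g ⧸ c.toSubmodule) η ∈ symInv c 1 :=
    fun η => by rw [symInv_one_eq]; exact ⟨_, η.2, rfl⟩
  let e : redLieAlg c ≃ symInv c 1 := Equiv.ofBijective (fun η => ⟨_, hmem η⟩) (by
    constructor
    · intro η η' h
      exact Subtype.ext (ι_injective _ (congrArg Subtype.val h))
    · rintro ⟨s, hs⟩
      have hs' := hs
      rw [symInv_one_eq] at hs'
      obtain ⟨η, hη, rfl⟩ := hs'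
      exact ⟨⟨η, hη⟩, rfl⟩)
  -- The bijection `e` induced by `ι` is equivariant, so it matches the relations defining the two
  -- quotients.
  have hrel : ∀ (n : autStab c) (η η' : redLieAlg c),
      e η' = quotRep c 1 (QuotientGroup.mk n) (e η) ↔
        (η' : g ⧸ c.toSubmodule) =
          quotAct c.toSubmodule ⟨n, autStab_le_linStab c n.2⟩ η := by
    intro n η η'
    rw [Subtype.ext_iff, ← (ι_injective (g ⧸ c.toSubmodule)).eq_iff]
    have h1 : (quotRep c 1 (QuotientGroup.mk n) (e η)).1 = SymmetricAlgebra.ι ℝ _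
        (quotAct c.toSubmodule ⟨n, autStab_le_linStab c n.2⟩ η) :=
      SymmetricAlgebra.lift_ι_apply _ _
    rw [h1]
    rfl
  refine ⟨Quot.congr (Equiv.prodCongr (Equiv.refl _) e) fun p q => ?_, fun a η => ?_⟩
  · constructor
    · rintro ⟨n, h1, h2⟩
      exact ⟨QuotientGroup.mk n, h1, (hrel n p.2 q.2).2 h2⟩
    · rintro ⟨ν, h1, h2⟩
      induction ν using QuotientGroup.induction_on with
      | H n => exact ⟨n, h1, (hrel n p.2 q.2).1 h2⟩
  · exact SymmetricAlgebra.lift_ι_apply _ _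

end Inclusions
end SternbergWeinstein

/-! ### The main theorem -/

theorem mainTheorem7
    {EX X ES S EQ Q E Z : Type*}
    [NormedAddCommGroup EX] [NormedSpace ℝ EX] [FiniteDimensional ℝ EX]
    [TopologicalSpace X] [T2Space X] [SigmaCompactSpace X] [ChartedSpace EX X]
    [IsManifold 𝓘(ℝ, EX) ∞ X]
    [NormedAddCommGroup ES] [NormedSpace ℝ ES] [FiniteDimensional ℝ ES]
    [TopologicalSpace S] [T2Space S] [SigmaCompactSpace S] [ChartedSpace ES S]
    [IsManifold 𝓘(ℝ, ES) ∞ S]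
    [NormedAddCommGroup EQ] [NormedSpace ℝ EQ] [FiniteDimensional ℝ EQ]
    [TopologicalSpace Q] [T2Space Q] [SigmaCompactSpace Q] [ChartedSpace EQ Q]
    [IsManifold 𝓘(ℝ, EQ) ∞ Q]
    [NormedAddCommGroup E] [NormedSpace ℝ E] [FiniteDimensional ℝ E]
    [TopologicalSpace Z] [T2Space Z] [SigmaCompactSpace Z] [ChartedSpace E Z]
    [IsManifold 𝓘(ℝ, E) ∞ Z]
    (P : PoissonStructure E Z) (J : Inclusions EX X ES S EQ Q E Z)
    (hS : P.IsSymplecticLeaf (EM := ES) (fun s => J.iQ (J.iS s)))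
    (hX : Manifold.IsSmoothEmbedding 𝓘(ℝ, EX) 𝓘(ℝ, ES) ∞ J.iX)
    (hXL : J.IsLagrangian P)
    (hQ : Manifold.IsSmoothEmbedding 𝓘(ℝ, EQ) 𝓘(ℝ, E) ∞ J.iQ)
    (hQC : P.IsCoisotropic (EM := EQ) J.iQ)
    {g : Type*} [LieRing g] [LieAlgebra ℝ g] [FiniteDimensional ℝ g] (c : LieSubalgebra ℝ g)
    (hred : ∀ x : X, Nonempty (J.ConstraintFrame P c x)) :
    -- vertically polynomial admissible functions are given by sections of `⊕_i L_i`
    {φ : J.EQuotDual → ℝ | φ ∈ J.reducedAlgebra P ∧ ∃ h ∈ J.vertPoly, φ = h ∘ J.projL} =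
      {φ | ∃ (d : ℕ) (h : ℕ → J.LQuotDual → ℝ), (∀ i, h i ∈ J.assocFun P c i) ∧
        φ = (∑ i ∈ Finset.range (d + 1), h i) ∘ J.projL} ∧
    -- vertically linear admissible functions are given by sections of `L_1`
    {φ : J.EQuotDual → ℝ | φ ∈ J.reducedAlgebra P ∧ ∃ h ∈ J.linFun, φ = h ∘ J.projL} =
      {φ | ∃ h ∈ J.assocFun P c 1, φ = h ∘ J.projL} ∧
    -- `(g/c)^C = N_g(c)/c`
    symInv c 1 = (redLieAlg c).map (SymmetricAlgebra.ι ℝ (g ⧸ c.toSubmodule)) ∧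
    -- `L_1 = (R_1 × N_g(c)/c) / N_1`
    ∀ x : X, ∃ Φ : J.RedAssocFiber P c x ≃ J.AssocFiber P c x 1,
      ∀ (a : J.ConstraintFrame P c x) (η : redLieAlg c),
        (Φ (Quot.mk _ (Quot.mk _ a, η))).toSym J =
          SymmetricAlgebra.ι ℝ (J.LQuotFiber x) (a.quotMap J η) := by
  have hinj := Inclusions.tangentQ_injective hQ
  have hzero : NormalBundle.IsSmooth
      (J.sectionFun fun x => (0 : SymmetricAlgebra ℝ (J.LQuotFiber x))) := by
    -- The zero section is treated as an empty sum of sections.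
    have h1 := Inclusions.isSmooth_sum (J := J) (∅ : Finset ℕ)
      (h := fun _ => J.sectionFun fun x => (0 : SymmetricAlgebra ℝ (J.LQuotFiber x))) (by simp)
    rw [← Inclusions.sectionFun_sum] at h1
    simpa only [Finset.sum_empty] using h1
  have hassoc : ∀ i, ∀ s : ∀ x, SymmetricAlgebra ℝ (J.LQuotFiber x),
      NormalBundle.IsSmooth (J.sectionFun s) → (∀ x, s x ∈ symPow (J.LQuotFiber x) i) →
      (∀ (x : X) (a : J.ConstraintFrame P c x) (s' : SymmetricAlgebra ℝ (g ⧸ c.toSubmodule)),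
        symMap (a.quotMap J) s' = s x → IsInfInvariant c s') →
      J.sectionFun s ∈ J.assocFun P c i := by
    intro i s hs hi hinv
    refine Inclusions.sectionFun_mem_assocFun hs fun x => ?_
    obtain ⟨a⟩ := hred x
    obtain ⟨s', hs', hpow⟩ := a.exists_symMap_eq (hinj x) (s x)
    exact ⟨a, s', (mem_symInv_iff_isInfInvariant c i s').2 ⟨hpow i (hi x), hinv x a s' hs'⟩, hs'⟩
  have hred' : ∀ {i : ℕ} (σ : ∀ x, J.AssocFiber P c x i),
      NormalBundle.IsSmooth (J.sectionFun fun x => (σ x).toSym J) →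
      (J.sectionFun fun x => (σ x).toSym J) ∘ J.projL ∈ J.reducedAlgebra P := by
    intro i σ hσ
    refine (Inclusions.mem_reducedAlgebra (c := c) hS hX hQ hσ).2 fun x => ?_
    obtain ⟨a, s', hs', h⟩ := (σ x).exists_rep
    exact ⟨a, s', h, ((mem_symInv_iff_isInfInvariant c i s').1 hs').2⟩
  have hpow : ∀ {i : ℕ} {x : X} (σ : J.AssocFiber P c x i),
      σ.toSym J ∈ symPow (J.LQuotFiber x) i := by
    intro i x σ
    obtain ⟨a, s', hs', h⟩ := σ.exists_rep
    rw [← h]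
    exact symMap_mem_symPow _ i ((mem_symInv_iff_isInfInvariant c i s').1 hs').1
  refine ⟨?_, ?_, symInv_one_eq c, fun x => Inclusions.exists_redAssocFiber_equiv x⟩
  · ext φ
    constructor
    · rintro ⟨hφ, h, ⟨hh, d, s, hs, rfl⟩, rfl⟩
      have hsmooth := fun {i} (hi : i < d + 1) => Inclusions.isSmooth_homogeneous hs hh hi
      rw [← Inclusions.sectionFun_sum] at hφ hh
      have hinv := (Inclusions.mem_reducedAlgebra (c := c) hS hX hQ hh).1 hφ
      -- A section is required in every degree, so the zero section fills the degrees above `d`.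
      refine ⟨d, fun i => if i < d + 1 then J.sectionFun (s i) else J.sectionFun fun _ => 0,
        fun i => ?_, ?_⟩
      · dsimp only
        split_ifs with hi
        · refine Inclusions.sectionFun_mem_assocFun (hsmooth hi) fun x => ?_
          obtain ⟨a⟩ := hred x
          -- All components are read in one frame, so that their sum represents the whole section
          -- there and invariance can be split by degree.
          choose s' hs' hpow' using fun k => a.exists_symMap_eq (hinj x) (s k x)
          have h1 : IsInfInvariant c (∑ k ∈ Finset.range (d + 1), s' k) := by
            refine hinv x a _ ?_
            rw [map_sum]
            exact Finset.sum_congr rfl fun k _ => hs' k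
          exact ⟨a, s' i, (mem_symInv_iff_isInfInvariant c i _).2
            ⟨hpow' i i (hs i x), h1.of_sum (fun k => hpow' k k (hs k x)) hi⟩, hs' i⟩
        · refine Inclusions.sectionFun_mem_assocFun hzero fun x => ?_
          obtain ⟨a⟩ := hred x
          exact ⟨a, 0, Submodule.zero_mem _, map_zero _⟩
      · congr 1
        exact Finset.sum_congr rfl fun i hi => (if_pos (Finset.mem_range.1 hi)).symm
    · rintro ⟨d, h, hh, rfl⟩
      choose hsm σ hσ using hh
      obtain rfl : h = fun i => J.sectionFun fun x => (σ i x).toSym J := funext hσ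
      have hsum := Inclusions.isSmooth_sum (Finset.range (d + 1)) fun i _ => hsm i
      refine ⟨?_, _, ⟨hsum, d, fun i x => (σ i x).toSym J, fun i x => hpow _, rfl⟩, rfl⟩
      rw [← Inclusions.sectionFun_sum] at hsum ⊢
      refine (Inclusions.mem_reducedAlgebra (c := c) hS hX hQ hsum).2 fun x => ?_
      obtain ⟨a⟩ := hred x
      choose s' hs' _ using fun k => a.exists_symMap_eq (hinj x) ((σ k x).toSym J)
      refine ⟨a, ∑ k ∈ Finset.range (d + 1), s' k, ?_, isInfInvariant_sum _ fun k _ => ?_⟩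
      · rw [map_sum]
        exact Finset.sum_congr rfl fun k _ => hs' k
      -- The different `σ k` need not be represented in a common frame. Each is first shown reduced
      -- in its own frame, which gives invariance in every frame, in particular in `a`.
      · exact (Inclusions.mem_reducedAlgebra hS hX hQ (hsm k)).1 (hred' (σ k) (hsm k)) x a _ (hs' k)
  · ext φ
    constructor
    · rintro ⟨hφ, h, ⟨hh, s, rfl⟩, rfl⟩
      exact ⟨_, hassoc 1 _ hh (fun x => by rw [symPow_one]; exact ⟨_, rfl⟩)
        ((Inclusions.mem_reducedAlgebra hS hX hQ hh).1 hφ), rfl⟩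
    · rintro ⟨h, ⟨hh, σ, rfl⟩, rfl⟩
      refine ⟨hred' σ hh, _, ⟨hh, ?_⟩, rfl⟩
      have h1 : ∀ x, ∃ v, SymmetricAlgebra.ι ℝ (J.LQuotFiber x) v = (σ x).toSym J := fun x => by
        have := hpow (σ x)
        rwa [symPow_one] at this
      choose v hv using h1
      exact ⟨v, congrArg J.sectionFun (funext fun x => (hv x).symm)⟩
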